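/- **Conventions.** Let $X_1,\dots,X_m$ ($m\ge 1$) be pointed CW-complexes, with basepoints all written $\ast$, and let $I=[0,1]$. The cone on a space $X$ is $CX=(X\times I)/(X\times\{1\})$, and $X$ is regarded as the subspace $X\times\{0\}$ of $CX$. For a simplicial complex $K$ on the vertex set $\{1,\dots,m\}$ (the empty simplex is always a simplex of $K$), the polyhedral product is $$(\underline{CX},\underline{X})^K=\bigcup_{\sigma\in K}\ \prod_{i=1}^m Y_i^\sigma\ \subseteq\ \prod_{i=1}^m CX_i,\qquad Y_i^\sigma=\begin{cases}CX_i & i\in\sigma,\\ X_i & i\notin\sigma,\end{cases}$$ with basepoint $(\ast,\dots,\ast)\in\prod_i X_i$. For pointed spaces $A,B$, the right half-smash $A\rtimes B$ is the quotient of $A\times B$ by $(\ast,b)\sim(\ast,b')$, based at the class of $\{\ast\}\times B$; the join $A*B$ is the quotient of $A\times I\times B$ by $(a,1,b)\sim(a',1,b)$ and $(a,0,b)\sim(a,0,b')$, based at the class of $(\ast,0,\ast)$. Products over an empty index set, and the polyhedral product over the empty vertex set, are a point. **Lemma.** Let $0\le k\le m-1$ and let $K$ be a simplicial complex on the vertex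 set $\{1,\dots,m\}$. Suppose that $K=K_1\cup\Delta^k$, where 1. $K_1$ is a simplicial complex on the vertex set $\{1,\dots,m-1\}$ and $\{i\}\in K_1$ for $1\le i\le m-1$; 2. $\Delta^k$ is the full $k$-simplex on the vertex set $\{m-k,\dots,m\}$; 3. $K_1\cap\Delta^k$ is the full $(k-1)$-simplex on the vertex set $\{m-k,\dots,m-1\}$ (only the empty simplex if $k=0$). Then there is a homotopy equivalence $$(\underline{CX},\underline{X})^K\simeq\Big(\big(\textstyle\prod_{i=1}^{m-k-1}X_i\big)*X_m\Big)\vee\Big((\underline{CX},\underline{X})^{K_1}\rtimes X_m\Big).$$ **Corollary.** Let $P_m$ be the simplicial complex consisting of the $m$ disjoint points $1,\dots,m$. Then there is a homotopy equivalence $$(\underline{CX},\underline{X})^{P_m}\simeq\Big(\big(\textstyle\prod_{i=1}^{m-1}X_i\big)*X_m\Big)\vee\Big((\underline{CX},\underline{X})^{P_{m-1}}\rtimes X_m\Big).$$ -/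

import Mathlib

/-! ### Simplicial complexes

A simplicial complex on a vertex set `ι` is a `PreAbstractSimplicialComplex ι`: a family of nonempty
finite subsets of `ι` closed under passing to nonempty subsets. The empty simplex belongs to every
simplicial complex by convention and is not recorded in the list of faces. -/

/-- The full simplex on the finite vertex set `V`: its faces are all nonempty subsets of `V`.
It has dimension `#V - 1`; for `V = ∅` it has only the empty face. -/
def fullSimplex {ι : Type*} (V : Finset ι) : PreAbstractSimplicialComplex ι where
  faces := {s | s.Nonempty ∧ s ⊆ V}
  isRelLowerSet_faces := fun _ hs => ⟨hs.1, fun _ hts ht => ⟨ht, hts.trans hs.2⟩⟩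

/-- The complex `P_m` of `m` disjoint points: its nonempty faces are exactly the singletons. -/
def disjointPoints (m : ℕ) : PreAbstractSimplicialComplex (Fin m) where
  faces := {s | ∃ v, s = {v}}
  isRelLowerSet_faces := by
    rintro s ⟨v, rfl⟩
    refine ⟨Finset.singleton_nonempty v, fun t ht hne => ?_⟩
    exact ⟨v, (Finset.subset_singleton_iff.1 ht).resolve_left hne.ne_empty⟩

/-! ### Polyhedral products -/

/-- The subspace `∏ Y_i` of `∏ X_i`, where `Y_i = X_i` for `i ∈ σ` and `Y_i = A_i` for `i ∉ σ`. -/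
def polyhedralPiece {ι : Type*} {X : ι → Type*} (A : ∀ i, Set (X i)) (σ : Finset ι) :
    Set (∀ i, X i) :=
  {x | ∀ i, i ∉ σ → x i ∈ A i}

/-- The polyhedral product of the pairs `(X_i, A_i)`: the union over all simplices `σ` of `K`,
the empty simplex included, of the subspaces `polyhedralPiece A σ`. -/
def polyhedralProduct {ι : Type*} {X : ι → Type*} (A : ∀ i, Set (X i))
    (K : PreAbstractSimplicialComplex ι) : Set (∀ i, X i) :=
  ⋃ σ ∈ {σ : Finset ι | σ = ∅ ∨ σ ∈ K}, polyhedralPiece A σ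

/-! ### Cone, join, half-smash and wedge

`Quot r` is the quotient by the equivalence relation generated by `r`, and it carries the quotient
topology. -/

/-- The cone `CX = X × I / X × {1}`. -/
def Cone (X : Type*) : Type _ :=
  Quot (fun p q : X × unitInterval => p.2 = 1 ∧ q.2 = 1)

instance (X : Type*) [TopologicalSpace X] : TopologicalSpace (Cone X) :=
  inferInstanceAs (TopologicalSpace (Quot _))

/-- The inclusion of `X` as the base `X × {0}` of the cone. -/
def Cone.incl {X : Type*} (x : X) : Cone X := Quot.mk _ (x, 0)

/-- The join `A * B`: the quotient of `A × I × B` by `(a, 1, b) ~ (a', 1, b)` and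
`(a, 0, b) ~ (a, 0, b')`. -/
def Join (A B : Type*) : Type _ :=
  Quot (fun p q : A × unitInterval × B =>
    (p.2.1 = 1 ∧ q.2.1 = 1 ∧ p.2.2 = q.2.2) ∨ (p.2.1 = 0 ∧ q.2.1 = 0 ∧ p.1 = q.1))

instance (A B : Type*) [TopologicalSpace A] [TopologicalSpace B] : TopologicalSpace (Join A B) :=
  inferInstanceAs (TopologicalSpace (Quot _))

/-- The basepoint `[a₀, 0, b₀]` of the join of two pointed spaces. -/
def Join.base {A B : Type*} (a₀ : A) (b₀ : B) : Join A B := Quot.mk _ (a₀, 0, b₀)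

/-- The right half-smash `A ⋊ B` of a space `A` with basepoint `a₀` and a space `B`: the quotient
of `A × B` that collapses `{a₀} × B` to a point. -/
def HalfSmash {A : Type*} (a₀ : A) (B : Type*) : Type _ :=
  Quot (fun p q : A × B => p.1 = a₀ ∧ q.1 = a₀)

instance {A : Type*} [TopologicalSpace A] (a₀ : A) (B : Type*) [TopologicalSpace B] :
    TopologicalSpace (HalfSmash a₀ B) :=
  inferInstanceAs (TopologicalSpace (Quot _))

/-- The basepoint of the half-smash: the class of `{a₀} × B`. -/
def HalfSmash.base {A B : Type*} (a₀ : A) (b₀ : B) : HalfSmash a₀ B := Quot.mk _ (a₀, b₀)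

/-- The wedge of two pointed spaces: the disjoint union with the two basepoints identified. -/
def Wedge {A B : Type*} (a₀ : A) (b₀ : B) : Type _ :=
  Quot (fun p q : A ⊕ B => p = Sum.inl a₀ ∧ q = Sum.inr b₀)

instance {A B : Type*} [TopologicalSpace A] [TopologicalSpace B] (a₀ : A) (b₀ : B) :
    TopologicalSpace (Wedge a₀ b₀) :=
  inferInstanceAs (TopologicalSpace (Quot _))

/-! ### The polyhedral product of the pairs `(CX_i, X_i)` -/

/-- The polyhedral product of the pairs `(CX_i, X_i)`, as a subspace of `∏ CX_i`. -/
def conePolyhedralProduct {ι : Type*} (X : ι → Type*) (K : PreAbstractSimplicialComplex ι) :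
    Set (∀ i, Cone (X i)) :=
  polyhedralProduct (fun i => Set.range (Cone.incl : X i → Cone (X i))) K

/-- The basepoint of the polyhedral product: the tuple of the basepoints of the `X_i ⊆ CX_i`. -/
def conePolyhedralProduct.base {ι : Type*} {X : ι → Type*} (x₀ : ∀ i, X i)
    (K : PreAbstractSimplicialComplex ι) : conePolyhedralProduct X K :=
  ⟨fun i => Cone.incl (x₀ i),
    Set.mem_biUnion (show (∅ : Finset ι) ∈ {σ : Finset ι | σ = ∅ ∨ σ ∈ K} from Or.inl rfl)
      (fun i _ => Set.mem_range_self (x₀ i))⟩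

section

open Set Topology unitInterval

/-! Write `A` for the polyhedral product of `K₁`, `X` for the last space, `F` for the common face of
`K₁` and the simplex, `B ⊆ A` for the piece of `F`, and `P` for the product of the `X_i` over the
vertices of `K₁` outside `F`. A face of `K` lies in `K₁` or in the simplex on `F` and the last
vertex, so the polyhedral product of `K` is `A × X ∪ B × CX`. This is a homotopy pushout of `A × X ←
B × X → B` (`nonempty_homotopyEquiv_coneUnion`).

The inclusion of `B` in `A` is null-homotopic: contract the cone coordinates in `F` together, then
move the other coordinates to the basepoint one at a time, which is possible because every vertex
belongs to `K₁` (`exists_nullhomotopy_conePolyhedralPiece`). Also `B` deformation retracts onto a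
copy of `P`. The pushout becomes that of `A × X ← P × X → P`, where the left map is `(p, x) ↦ (a₀,
x)`. Since this map factors through the projection to `X`, the pushout is the join `P * X` with its
end `X` connected by a cylinder to `{a₀} × X ⊆ A × X`. The end `X` is null-homotopic in the join, so
the cylinder can be attached to a single point of it; collapsing what remains gives the wedge with
the half-smash `A ⋊ X`.

Homotopy pushouts are modelled by `DoubleCylinder`, and all homotopies are free. Only the last
collapse needs a condition on the basepoint, namely a `LocalContraction` of `A` at `a₀`. It is the
only use of the CW structures: each `X_i` has one by homotopy extension, and it passes to cones,
finite products and invariant subspaces by explicit formulas. -/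

/-- A contraction of a neighbourhood of `a₀` in `A` onto `a₀` through self-maps of the whole space:
a homotopy starting at the identity and fixing `a₀`, with a height function which vanishes at
time `0`, which is `1` at `a₀` at time `1`, and which is nonzero only where the homotopy takes
the value `a₀`. -/
structure LocalContraction {A : Type*} [TopologicalSpace A] (a₀ : A) where
  map : A × I → A
  height : A × I → I
  continuous_map : Continuous map
  continuous_height : Continuous height
  map_zero : ∀ a, map (a, 0) = a
  map_base : ∀ t, map (a₀, t) = a₀
  height_zero : ∀ a, height (a, 0) = 0
  height_base : height (a₀, 1) = 1
  map_eq : ∀ p, height p ≠ 0 → map p = a₀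

/-! ### Homotopy extension for CW complexes -/

section HomotopyExtension

open Metric

/-- The homotopy extension property of the unit ball relative to the unit sphere. -/
theorem exists_homotopy_extension_closedBall {E Y : Type*} [NormedAddCommGroup E]
    [NormedSpace ℝ E] [TopologicalSpace Y] {f : E → Y} {g : E → C(I, Y)}
    (hf : ContinuousOn f (closedBall 0 1)) (hg : ContinuousOn g (sphere 0 1))
    (h0 : ∀ y ∈ sphere (0 : E) 1, g y 0 = f y) :
    ∃ G : E → C(I, Y), ContinuousOn G (closedBall 0 1) ∧ (∀ y ∈ sphere (0 : E) 1, G y = g y) ∧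
      ∀ y ∈ closedBall (0 : E) 1, G y 0 = f y := by
  classical
  -- The cylinder over the ball is retracted onto its bottom and its side by projecting from the
  -- point `(0, 2)` above it. The ray through `(y, t)` meets the bottom at `(1 - t/2)⁻¹ • y` if `‖y‖
  -- ≤ 1 - t/2`, and otherwise the side at height `2 - (2 - t)/‖y‖`.
  let k : closedBall (0 : E) 1 × I → Y := fun p =>
    if ‖(p.1 : E)‖ ≤ 1 - (p.2 : ℝ) / 2 then f ((1 - (p.2 : ℝ) / 2)⁻¹ • (p.1 : E))
    else g (‖(p.1 : E)‖⁻¹ • (p.1 : E)) (projIcc 0 1 zero_le_one (2 - (2 - (p.2 : ℝ)) / ‖(p.1 : E)‖))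
  have hk : Continuous k := by
    refine continuous_if_le (by fun_prop) (by fun_prop) ?_ ?_ ?_
    · refine hf.comp (Continuous.continuousOn ?_) ?_
      · refine Continuous.smul (Continuous.inv₀ (by fun_prop) fun p => ?_) (by fun_prop)
        have := p.2.2.2
        linarith
      · intro p hp
        have h1 := p.2.2.2
        have h2 : (0 : ℝ) < 1 - (p.2 : ℝ) / 2 := by linarith
        rw [mem_closedBall_zero_iff, norm_smul, norm_inv, Real.norm_of_nonneg h2.le,
          inv_mul_le_iff₀ h2, mul_one]
        exact hp
    · have hpos : ∀ p ∈ {p : closedBall (0 : E) 1 × I | 1 - (p.2 : ℝ) / 2 ≤ ‖(p.1 : E)‖},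
          ‖(p.1 : E)‖ ≠ 0 := by
        intro p hp
        have h1 := p.2.2.2
        have : 1 - (p.2 : ℝ) / 2 ≤ ‖(p.1 : E)‖ := hp
        linarith
      refine ContinuousOn.eval (hg.comp ?_ ?_) ?_
      · exact (ContinuousOn.inv₀ (by fun_prop) hpos).smul (by fun_prop)
      · intro p hp
        rw [mem_sphere_zero_iff_norm, norm_smul, norm_inv, norm_norm]
        exact inv_mul_cancel₀ (hpos p hp)
      · exact continuous_projIcc.comp_continuousOn
          (continuousOn_const.sub (ContinuousOn.div (by fun_prop) (by fun_prop) hpos))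
    · intro p hp
      have h1 := p.2.2.2
      have h2 : (0 : ℝ) < 1 - (p.2 : ℝ) / 2 := by linarith
      have h3 : (2 - (2 - (p.2 : ℝ)) / ‖(p.1 : E)‖) = 0 := by
        have h5 : 2 - (p.2 : ℝ) = 2 * ‖(p.1 : E)‖ := by rw [hp]; ring
        rw [h5, mul_div_assoc, div_self (by rw [hp]; exact h2.ne')]; ring
      have h4 : projIcc (0 : ℝ) 1 zero_le_one (2 - (2 - (p.2 : ℝ)) / ‖(p.1 : E)‖) = 0 := by
        rw [h3]; exact projIcc_left _
      rw [h4, ← hp, h0]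
      rw [mem_sphere_zero_iff_norm, norm_smul, norm_inv, norm_norm, inv_mul_cancel₀]
      rw [hp]; exact h2.ne'
  let K : C(closedBall (0 : E) 1, C(I, Y)) := ContinuousMap.curry ⟨k, hk⟩
  have hK : ∀ y t, K y t = k (y, t) := fun _ _ => rfl
  refine ⟨fun y => if h : y ∈ closedBall (0 : E) 1 then K ⟨y, h⟩ else g y, ?_, ?_, ?_⟩
  · rw [continuousOn_iff_continuous_domRestrict]
    convert K.continuous using 1
    ext1 y
    simp only [domRestrict_apply]
    exact dif_pos y.2
  · intro y hy
    have hy' := sphere_subset_closedBall hy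
    rw [mem_sphere_zero_iff_norm] at hy
    simp only [dif_pos hy']
    ext t
    rw [hK]
    simp only [k, hy, inv_one, one_smul, div_one]
    split_ifs with h
    · have : t = 0 := by
        apply Subtype.ext
        have := t.2.1
        simp only [Icc.coe_zero]; linarith
      subst this
      simp only [Icc.coe_zero, zero_div, sub_zero, inv_one, one_smul]
      rw [h0]; simpa using hy
    · congr 1
      have : (2 : ℝ) - (2 - t) = t := by ring
      rw [this, projIcc_val]
  · intro y hy
    simp only [dif_pos hy, hK]
    have hy' : ‖y‖ ≤ 1 := by simpa using hy
    simp [k, hy']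

namespace CWExtension

open Topology.CWComplex

variable {X Y : Type*} [TopologicalSpace X] [CWComplex (univ : Set X)]
  [TopologicalSpace Y]

theorem symm_map {m : ℕ} {j : cell (univ : Set X) m} {y : Fin m → ℝ} (hy : y ∈ ball 0 1) :
    (map m j).symm (map m j y) = y :=
  (map m j).left_inv (by rwa [RelCWComplex.source_eq])

theorem eq_of_mem_openCell {m : ℕ} {j j' : cell (univ : Set X) m} {x : X}
    (h : x ∈ openCell m j) (h' : x ∈ openCell m j') : j = j' := by
  by_contra hne
  exact (disjoint_openCell_of_ne (by simpa using hne)).le_bot ⟨h, h'⟩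

variable [T2Space X]

/-- In the weak topology, closedness of a preimage is tested on closed cells. For a cell of
dimension below `n`, the preimage meets the closed cell in the image of a compact set under the
characteristic map; higher open cells miss the skeleton. -/
theorem continuousOn_skeletonLT {g : X → Y} {n : ℕ}
    (h : ∀ m < n, ∀ j : cell (univ : Set X) m, ContinuousOn (g ∘ map m j) (closedBall 0 1)) :
    ContinuousOn g (skeletonLT (univ : Set X) n) := by
  rw [continuousOn_iff_isClosed]
  intro t ht
  refine ⟨g ⁻¹' t ∩ skeletonLT (univ : Set X) n, ?_, by rw [inter_assoc, inter_self]⟩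
  rw [CWComplex.closed univ _ (subset_univ _)]
  suffices H : ∀ m, (m < n) → ∀ j : cell (univ : Set X) m,
      IsClosed ((g ⁻¹' t ∩ skeletonLT (univ : Set X) n) ∩ closedCell m j) by
    rw [← CWComplex.closed univ _ (subset_univ _)]
    refine CWComplex.isClosed_of_disjoint_openCell_or_isClosed_inter_closedCell
      (subset_univ _) fun m _ j => ?_
    rcases lt_or_ge m n with hm | hm
    · exact Or.inr (H m hm j)
    · refine Or.inl (Disjoint.mono_left inter_subset_right ?_)
      exact disjoint_skeletonLT_openCell (by exact_mod_cast hm)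
  intro m hm j
  have hsub : closedCell m j ⊆ (skeletonLT (univ : Set X) n : Set X) :=
    (closedCell_subset_skeletonLT m j).trans
      (SetLike.coe_subset_coe.2 (skeletonLT_mono (by exact_mod_cast hm)))
  have : (g ⁻¹' t ∩ skeletonLT (univ : Set X) n) ∩ closedCell m j =
      map m j '' (closedBall 0 1 ∩ (g ∘ map m j) ⁻¹' t) := by
    ext x
    constructor
    · rintro ⟨⟨hx, -⟩, y, hy, rfl⟩
      exact ⟨y, ⟨hy, hx⟩, rfl⟩
    · rintro ⟨y, ⟨hy, hx⟩, rfl⟩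
      exact ⟨⟨hx, hsub ⟨y, hy, rfl⟩⟩, y, hy, rfl⟩
  rw [this]
  have hc : IsClosed (closedBall 0 1 ∩ (g ∘ map m j) ⁻¹' t) :=
    (h m hm j).preimage_isClosed_of_isClosed isClosed_closedBall ht
  exact (((isCompact_closedBall _ _).of_isClosed_subset hc inter_subset_left).image_of_continuousOn
    ((RelCWComplex.continuousOn m j).mono inter_subset_left)).isClosed

theorem notMem_openCell_of_mem_skeletonLT {m : ℕ} {j : cell (univ : Set X) m} {x : X}
    (hx : x ∈ skeletonLT (univ : Set X) m) : x ∉ openCell m j := fun h =>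
  (disjoint_skeletonLT_openCell le_rfl).le_bot ⟨hx, h⟩

theorem map_mem_skeletonLT {m n : ℕ} (hm : m < n) (j : cell (univ : Set X) m) {y : Fin m → ℝ}
    (hy : y ∈ closedBall 0 1) : map m j y ∈ skeletonLT (univ : Set X) n :=
  skeletonLT_mono (by exact_mod_cast hm : ((m : ℕ∞) + 1) ≤ n)
    (closedCell_subset_skeletonLT m j ⟨y, hy, rfl⟩)

/-- The induction step over `n`-cells. The boundary of each `n`-cell lies in the skeleton where `g`
is already continuous, so the ball lemma extends the homotopy over each cell separately, and the
open cells are disjoint. -/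
theorem exists_extension_succ {f : X → Y} (hf : Continuous f) {n : ℕ} {g : X → C(I, Y)}
    (hg : ContinuousOn g (skeletonLT (univ : Set X) n))
    (h0 : ∀ x ∈ skeletonLT (univ : Set X) n, g x 0 = f x) :
    ∃ G : X → C(I, Y), ContinuousOn G (skeletonLT (univ : Set X) (n + 1 : ℕ)) ∧
      (∀ x ∈ skeletonLT (univ : Set X) n, G x = g x) ∧
      ∀ x ∈ skeletonLT (univ : Set X) (n + 1 : ℕ), G x 0 = f x := by
  classical
  have key : ∀ j : cell (univ : Set X) n, _ := fun j =>
    exists_homotopy_extension_closedBall (f := f ∘ map n j) (g := g ∘ map n j)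
      (hf.comp_continuousOn (RelCWComplex.continuousOn n j))
      (hg.comp ((RelCWComplex.continuousOn n j).mono sphere_subset_closedBall)
        fun y hy => cellFrontier_subset_skeletonLT n j ⟨y, hy, rfl⟩)
      fun y hy => h0 _ (cellFrontier_subset_skeletonLT n j ⟨y, hy, rfl⟩)
  choose c hc hcg hcf using key
  let G : X → C(I, Y) := fun x =>
    if h : ∃ j, x ∈ openCell n j then c h.choose ((map n h.choose).symm x) else g x
  have hG1 : ∀ x ∈ skeletonLT (univ : Set X) n, G x = g x := fun x hx =>
    dif_neg fun ⟨j, hj⟩ => notMem_openCell_of_mem_skeletonLT hx hj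
  have hG2 : ∀ j, ∀ y ∈ closedBall 0 1, G (map n j y) = c j y := by
    intro j y hy
    rw [← ball_union_sphere] at hy
    rcases hy with hy | hy
    · have h : ∃ j', map n j y ∈ openCell n j' := ⟨j, y, hy, rfl⟩
      have hj : h.choose = j := eq_of_mem_openCell h.choose_spec ⟨y, hy, rfl⟩
      simp only [G, dif_pos h]
      rw [hj, symm_map hy]
    · rw [hG1 _ (cellFrontier_subset_skeletonLT n j ⟨y, hy, rfl⟩), hcg j y hy]
      rfl
  refine ⟨G, continuousOn_skeletonLT fun m hm j => ?_, hG1, fun x hx => ?_⟩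
  · rcases (Nat.lt_succ_iff_lt_or_eq.1 hm) with hm | rfl
    · refine (hg.comp (RelCWComplex.continuousOn m j) fun y hy => map_mem_skeletonLT hm j hy).congr ?_
      exact fun y hy => hG1 _ (map_mem_skeletonLT hm j hy)
    · exact (hc j).congr (hG2 j)
  · rw [mem_skeletonLT_iff] at hx
    obtain ⟨m, hm, j, hj⟩ := hx
    have hm : m < n + 1 := by exact_mod_cast hm
    obtain ⟨y, hy, rfl⟩ := openCell_subset_closedCell m j hj
    rcases (Nat.lt_succ_iff_lt_or_eq.1 hm) with hm | rfl
    · rw [hG1 _ (map_mem_skeletonLT hm j hy), h0 _ (map_mem_skeletonLT hm j hy)]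
    · rw [hG2 j y hy, hcf j y hy]; rfl

/-- The homotopy extension property of a CW complex relative to a skeleton. -/
theorem exists_extension {f : X → Y} (hf : Continuous f) {n : ℕ} {g : X → C(I, Y)}
    (hg : ContinuousOn g (skeletonLT (univ : Set X) n))
    (h0 : ∀ x ∈ skeletonLT (univ : Set X) n, g x 0 = f x) :
    ∃ G : C(X, C(I, Y)), (∀ x ∈ skeletonLT (univ : Set X) n, G x = g x) ∧ ∀ x, G x 0 = f x := by
  classical
  let T : ℕ → Type _ := fun k => {g : X → C(I, Y) //
    ContinuousOn g (skeletonLT (univ : Set X) (n + k : ℕ)) ∧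
      ∀ x ∈ skeletonLT (univ : Set X) (n + k : ℕ), g x 0 = f x}
  let next : ∀ k, T k → T (k + 1) := fun k s =>
    ⟨(exists_extension_succ hf s.2.1 s.2.2).choose,
      (exists_extension_succ hf s.2.1 s.2.2).choose_spec.1,
      (exists_extension_succ hf s.2.1 s.2.2).choose_spec.2.2⟩
  let s : ∀ k, T k := fun k => Nat.rec (⟨g, hg, h0⟩ : T 0) next k
  have hs : ∀ k, ∀ x ∈ skeletonLT (univ : Set X) (n + k : ℕ), (s (k + 1)).1 x = (s k).1 x :=
    fun k => (exists_extension_succ hf (s k).2.1 (s k).2.2).choose_spec.2.1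
  have hs' : ∀ k l, k ≤ l → ∀ x ∈ skeletonLT (univ : Set X) (n + k : ℕ),
      (s l).1 x = (s k).1 x := by
    intro k l hkl
    induction l, hkl using Nat.le_induction with
    | base => exact fun _ _ => rfl
    | succ l hkl ih =>
      intro x hx
      rw [hs l x (skeletonLT_mono (by exact_mod_cast Nat.add_le_add_left hkl n) hx), ih x hx]
  have hex : ∀ x : X, ∃ k : ℕ, x ∈ skeletonLT (univ : Set X) (n + k : ℕ) := by
    intro x
    have : x ∈ ⋃ k : ℕ, (skeletonLT (univ : Set X) k : Set X) := by
      rw [iUnion_skeletonLT_eq_complex]; trivial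
    obtain ⟨k, hk⟩ := mem_iUnion.1 this
    exact ⟨k, skeletonLT_mono (by exact_mod_cast Nat.le_add_left k n) hk⟩
  choose N hN using hex
  let G : X → C(I, Y) := fun x => (s (N x)).1 x
  have hG : ∀ k, ∀ x ∈ skeletonLT (univ : Set X) (n + k : ℕ), G x = (s k).1 x := by
    intro k x hx
    rcases le_total (N x) k with h | h
    · exact (hs' _ _ h x (hN x)).symm
    · exact hs' _ _ h x hx
  have hcont : Continuous G := by
    refine continuous_iff_isClosed.2 fun t ht => ?_
    rw [CWComplex.closed univ _ (subset_univ _)]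
    intro m j
    -- The stages are compatible, and a closed `m`-cell already lies in stage `m + 1`, so continuity
    -- on that cell is continuity of a single stage.
    have h1 : ContinuousOn G (skeletonLT (univ : Set X) (n + (m + 1) : ℕ)) :=
      (s (m + 1)).2.1.congr (hG _)
    have h2 : closedCell m j ⊆ (skeletonLT (univ : Set X) (n + (m + 1) : ℕ) : Set X) := by
      rintro _ ⟨y, hy, rfl⟩
      exact map_mem_skeletonLT (by omega) j hy
    rw [inter_comm]
    exact (h1.mono h2).preimage_isClosed_of_isClosed isClosed_closedCell ht
  refine ⟨⟨G, hcont⟩, fun x hx => hG 0 x hx, fun x => (s (N x)).2.2 x (hN x)⟩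

end CWExtension

end HomotopyExtension

/-! ### Local contractions in CW complexes -/

namespace CWExtension

open Metric Topology.CWComplex

/-- Inside the unit ball, an interior point `y₀` has a local contraction which is stationary
on the unit sphere. -/
theorem exists_contraction_closedBall {E : Type*} [NormedAddCommGroup E] [NormedSpace ℝ E]
    {y₀ : E} (hy₀ : y₀ ∈ ball (0 : E) 1) :
    ∃ (p : E × I → E) (v : E × I → I), Continuous p ∧ Continuous v ∧
      (∀ y t, y ∈ closedBall 0 1 → p (y, t) ∈ closedBall 0 1) ∧
      (∀ y, p (y, 0) = y) ∧ (∀ y, v (y, 0) = 0) ∧ (∀ t, p (y₀, t) = y₀) ∧ v (y₀, 1) = 1 ∧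
      (∀ q, v q ≠ 0 → p q = y₀) ∧
      ∀ y ∈ sphere (0 : E) 1, ∀ t, p (y, t) = y ∧ v (y, t) = 0 := by
  have hy₀' : ‖y₀‖ < 1 := by simpa using hy₀
  -- The unit sphere is at distance at least `2δ` from `y₀`. The weight `l` pulls points towards
  -- `y₀`: it vanishes beyond distance `2δ`, and is `1` within distance `δ` from time `1/2` on. The
  -- height `w` is positive only within distance `δ` and after time `1/2`, where the point has
  -- already arrived at `y₀`.
  set δ : ℝ := (1 - ‖y₀‖) / 2 with hδ
  have hδ0 : 0 < δ := by linarith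
  let l : E × I → ℝ := fun q => min 1 (2 * (q.2 : ℝ)) * max 0 (min 1 (2 - ‖q.1 - y₀‖ / δ))
  let w : E × I → ℝ := fun q => max 0 (2 * (q.2 : ℝ) - 1) * max 0 (1 - ‖q.1 - y₀‖ / δ)
  have hl0 : ∀ q, 0 ≤ l q := fun q =>
    mul_nonneg (le_min zero_le_one (by linarith [q.2.2.1])) (le_max_left _ _)
  have hl1 : ∀ q, l q ≤ 1 := fun q => by
    refine mul_le_one₀ (min_le_left _ _) (le_max_left _ _) (max_le zero_le_one (min_le_left _ _))
  have hw0 : ∀ q, 0 ≤ w q := fun q => mul_nonneg (le_max_left _ _) (le_max_left _ _)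
  have hsph : ∀ y ∈ sphere (0 : E) 1, 2 ≤ ‖y - y₀‖ / δ := by
    intro y hy
    rw [mem_sphere_zero_iff_norm] at hy
    rw [le_div_iff₀ hδ0]
    have := norm_sub_norm_le y y₀
    linarith
  refine ⟨fun q => q.1 - l q • (q.1 - y₀), fun q => projIcc 0 1 zero_le_one (w q),
    by fun_prop, continuous_projIcc.comp (by fun_prop), ?_, ?_, ?_, ?_, ?_, ?_, ?_⟩
  · intro y t hy
    have h := (convex_closedBall (0 : E) 1) hy (ball_subset_closedBall hy₀)
      (sub_nonneg.2 (hl1 (y, t))) (hl0 (y, t)) (by ring)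
    convert h using 1
    module
  · intro y; simp [l]
  · intro y
    have : w (y, 0) = 0 := by simp [w]
    simp only [this]; exact projIcc_left _
  · intro t; simp
  · have : w (y₀, 1) = 1 := by simp [w]; norm_num
    simp only [this]; exact projIcc_right _
  · intro q hq
    have hwq : w q ≠ 0 := by
      intro h; apply hq; simp only [h]; exact projIcc_left _
    have h1 : 0 < 2 * (q.2 : ℝ) - 1 := by
      by_contra h
      exact hwq (by simp only [w]; rw [max_eq_left (not_lt.1 h), zero_mul])
    have h2 : 0 < 1 - ‖q.1 - y₀‖ / δ := by
      by_contra h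
      exact hwq (by simp only [w]; rw [max_eq_left (not_lt.1 h), mul_zero])
    have : l q = 1 := by
      simp only [l]
      rw [min_eq_left (by linarith), min_eq_left (by linarith), max_eq_right zero_le_one, one_mul]
    simp only [this]; module
  · intro y hy t
    have h := hsph y hy
    have h1 : l (y, t) = 0 := by
      simp only [l]
      rw [max_eq_left ((min_le_right _ _).trans (by linarith)), mul_zero]
    have h2 : w (y, t) = 0 := by
      simp only [w]
      rw [max_eq_left (by linarith : 1 - ‖y - y₀‖ / δ ≤ 0), mul_zero]
    simp only [h1, h2]
    exact ⟨by simp, projIcc_left _⟩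

variable {X : Type*} [TopologicalSpace X] [T2Space X] [CWComplex (univ : Set X)]

/-- Every point of a CW complex has a local contraction. -/
theorem nonempty_localContraction (x₀ : X) : Nonempty (LocalContraction x₀) := by
  classical
  obtain ⟨d, j₀, hx₀⟩ : ∃ d, ∃ j : cell (univ : Set X) d, x₀ ∈ openCell d j := by
    have h : x₀ ∈ ⋃ (n : ℕ) (j : cell (univ : Set X) n), openCell n j := by
      rw [CWComplex.iUnion_openCell_eq_complex]; trivial
    simpa using h
  obtain ⟨y₀, hy₀, hx₀'⟩ := hx₀
  obtain ⟨p, v, hp, hv, hpB, hp0, hv0, hpy, hvy, hpv, hS⟩ := exists_contraction_closedBall hy₀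
  -- `M` is `X` with a whisker `{x₀} × I` attached at `x₀`. A local contraction is a homotopy from
  -- the inclusion `X → M` which keeps the image of `x₀` in the whisker and ends with it at the tip,
  -- so it can be built by homotopy extension with target `M`.
  let M : Type _ := {q : X × I // q.2 ≠ 0 → q.1 = x₀}
  let f : X → M := fun x => ⟨(x, 0), fun h => (h rfl).elim⟩
  have hf : Continuous f := by fun_prop
  let c : C(X, C(I, M)) := ContinuousMap.curry ⟨fun q : X × I => f q.1, by fun_prop⟩
  have hc : ∀ x t, c x t = f x := fun _ _ => rfl
  let K : C(closedBall (0 : Fin d → ℝ) 1, C(I, M)) := ContinuousMap.curry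
    ⟨fun q => ⟨(map d j₀ (p (q.1, q.2)), v (q.1, q.2)), fun h => by
      simp only [hpv _ h, hx₀']⟩, by
      refine Continuous.subtype_mk (Continuous.prodMk ?_ (by fun_prop)) _
      exact (RelCWComplex.continuousOn d j₀).comp_continuous (by fun_prop)
        fun q => hpB _ _ q.1.2⟩
  have hK : ∀ y t, (K y t).1 = (map d j₀ (p (y, t)), v (y, t)) := fun _ _ => rfl
  let k : (Fin d → ℝ) → C(I, M) := fun y => if h : y ∈ closedBall 0 1 then K ⟨y, h⟩ else c x₀
  have hk : ∀ y (h : y ∈ closedBall 0 1), k y = K ⟨y, h⟩ := fun y h => dif_pos h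
  have hkc : ContinuousOn k (closedBall 0 1) := by
    rw [continuousOn_iff_continuous_domRestrict]
    convert K.continuous using 1
    ext1 y
    exact hk _ y.2
  have hks : ∀ y ∈ sphere 0 1, k y = c (map d j₀ y) := by
    intro y hy
    rw [hk y (sphere_subset_closedBall hy)]
    ext1 t
    apply Subtype.ext
    rw [hK, (hS y hy t).1, (hS y hy t).2]
    rfl
  -- The homotopy moves only the open cell of `x₀`. It is continuous on the cells of dimension at
  -- most `d`, but perhaps not beyond, since higher cells may be attached to this cell; extension
  -- from that skeleton repairs this.
  let g : X → C(I, M) := fun x => if x ∈ openCell d j₀ then k ((map d j₀).symm x) else c x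
  have hg1 : ∀ y ∈ closedBall 0 1, g (map d j₀ y) = k y := by
    intro y hy
    rw [← ball_union_sphere] at hy
    rcases hy with hy | hy
    · have : map d j₀ y ∈ openCell d j₀ := ⟨y, hy, rfl⟩
      simp only [g, if_pos this, symm_map hy]
    · have : map d j₀ y ∉ openCell d j₀ :=
        notMem_openCell_of_mem_skeletonLT (cellFrontier_subset_skeletonLT d j₀ ⟨y, hy, rfl⟩)
      simp only [g, if_neg this, hks y hy]
  have hg : ContinuousOn g (skeletonLT (univ : Set X) (d + 1 : ℕ)) := by
    refine continuousOn_skeletonLT fun m hm j => ?_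
    by_cases hj : (⟨m, j⟩ : Σ m, cell (univ : Set X) m) = ⟨d, j₀⟩
    · cases hj
      exact hkc.congr hg1
    · refine ((c.continuous.comp_continuousOn (RelCWComplex.continuousOn m j))).congr ?_
      intro y hy
      have : map m j y ∉ openCell d j₀ := by
        rw [← ball_union_sphere] at hy
        rcases hy with hy | hy
        · exact fun h => (disjoint_openCell_of_ne hj).le_bot ⟨⟨y, hy, rfl⟩, h⟩
        · refine notMem_openCell_of_mem_skeletonLT (skeletonLT_mono ?_
            (cellFrontier_subset_skeletonLT m j ⟨y, hy, rfl⟩))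
          exact_mod_cast Nat.lt_succ_iff.1 hm
      simp only [Function.comp, g, if_neg this]
  have hg0 : ∀ x, g x 0 = f x := by
    intro x
    by_cases hx : x ∈ openCell d j₀
    · obtain ⟨y, hy, rfl⟩ := hx
      rw [hg1 y (ball_subset_closedBall hy), hk y (ball_subset_closedBall hy)]
      apply Subtype.ext
      rw [hK, hp0, hv0]
    · simp only [g, if_neg hx, hc]
  obtain ⟨G, hGg, hG0⟩ := exists_extension hf hg fun x _ => hg0 x
  let val : M → X × I := Subtype.val
  have hval : Continuous val := continuous_subtype_val
  have hGx : ∀ t, val (G x₀ t) = (x₀, v (y₀, t)) := by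
    intro t
    have h1 : x₀ ∈ skeletonLT (univ : Set X) (d + 1 : ℕ) := by
      have := map_mem_skeletonLT (Nat.lt_succ_self d) j₀ (ball_subset_closedBall hy₀)
      rwa [hx₀'] at this
    have h2 : g x₀ = k y₀ := by rw [← hg1 _ (ball_subset_closedBall hy₀), hx₀']
    rw [hGg _ h1, h2, hk _ (ball_subset_closedBall hy₀)]
    refine (hK _ _).trans ?_
    rw [hpy, hx₀']
  have hGc : Continuous fun q : X × I => val (G q.1 q.2) := by fun_prop
  exact ⟨{
    map := fun q => (val (G q.1 q.2)).1
    height := fun q => (val (G q.1 q.2)).2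
    continuous_map := continuous_fst.comp hGc
    continuous_height := continuous_snd.comp hGc
    map_zero := fun x => by simp only [hG0, f, val]
    map_base := fun t => by simp only [hGx]
    height_zero := fun x => by simp only [hG0, f, val]
    height_base := by simp only [hGx, hvy]
    map_eq := fun q => (G q.1 q.2).2 }⟩

end CWExtension

/-! ### Clamping to the unit interval -/

/-- The nearest point of the unit interval to a real number. -/
noncomputable def clampI (r : ℝ) : I := projIcc 0 1 zero_le_one r

@[fun_prop]
theorem continuous_clampI : Continuous clampI := continuous_projIcc (h := zero_le_one)

theorem clampI_of_nonpos {r : ℝ} (h : r ≤ 0) : clampI r = 0 := projIcc_of_le_left _ h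

theorem clampI_of_one_le {r : ℝ} (h : 1 ≤ r) : clampI r = 1 := projIcc_of_right_le _ h

@[simp] theorem clampI_zero : clampI 0 = 0 := clampI_of_nonpos le_rfl

@[simp] theorem clampI_one : clampI 1 = 1 := clampI_of_one_le le_rfl

@[simp] theorem clampI_coe (t : I) : clampI t = t := projIcc_val _ t

theorem coe_clampI {r : ℝ} (h0 : 0 ≤ r) (h1 : r ≤ 1) : (clampI r : ℝ) = r := by
  rw [clampI, projIcc_of_mem zero_le_one ⟨h0, h1⟩]

theorem clampI_ne_zero {r : ℝ} : clampI r ≠ 0 ↔ 0 < r := by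
  constructor
  · intro h
    by_contra h'
    exact h (clampI_of_nonpos (not_lt.1 h'))
  · intro h h'
    have := congrArg (fun t : I => (t : ℝ)) h'
    rcases le_total r 1 with h1 | h1
    · simp only [coe_clampI h.le h1, Icc.coe_zero] at this; exact h.ne' this
    · simp [clampI_of_one_le h1] at this

/-! ### Cones -/

namespace Cone

variable {X : Type*}

/-- The point of the cone over `x` at height `s`. -/
def mk (x : X) (s : I) : Cone X := Quot.mk _ (x, s)

theorem incl_eq (x : X) : incl x = mk x 0 := rfl

theorem mk_one (x y : X) : mk x 1 = mk y 1 := Quot.sound ⟨rfl, rfl⟩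

theorem exists_eq_mk (c : Cone X) : ∃ x s, c = mk x s := by
  induction c using Quot.ind with
  | mk p => exact ⟨p.1, p.2, rfl⟩

/-- The height of a point of the cone above the base. -/
def height (c : Cone X) : I := Quot.lift (fun p => p.2) (fun _ _ h => h.1.trans h.2.symm) c

/-- The base point below a point of the cone; the apex is sent to `x₀`. -/
noncomputable def proj (x₀ : X) (c : Cone X) : X :=
  open Classical in
  Quot.lift (fun p : X × I => if p.2 = 1 then x₀ else p.1)
    (fun _ _ h => by rw [if_pos h.1, if_pos h.2]) c

@[simp] theorem height_mk (x : X) (s : I) : height (mk x s) = s := rfl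

@[simp] theorem height_incl (x : X) : height (incl x) = 0 := rfl

theorem proj_mk (x₀ x : X) {s : I} (hs : s ≠ 1) : proj x₀ (mk x s) = x := if_neg hs

@[simp] theorem proj_incl (x₀ x : X) : proj x₀ (incl x) = x := proj_mk _ _ zero_ne_one

theorem mk_proj (x₀ : X) (c : Cone X) : mk (proj x₀ c) (height c) = c := by
  obtain ⟨x, s, rfl⟩ := exists_eq_mk c
  by_cases hs : s = 1
  · subst hs; exact mk_one _ _
  · rw [proj_mk _ _ hs, height_mk]

theorem incl_proj (x₀ : X) {c : Cone X} (hc : height c = 0) : incl (proj x₀ c) = c := by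
  conv_rhs => rw [← mk_proj x₀ c, hc]
  rfl

theorem mem_range_incl {c : Cone X} : c ∈ range (incl : X → Cone X) ↔ height c = 0 := by
  constructor
  · rintro ⟨x, rfl⟩; rfl
  · intro h
    obtain ⟨x, s, rfl⟩ := exists_eq_mk c
    exact ⟨x, by rw [height_mk] at h; rw [h]; rfl⟩

variable [TopologicalSpace X]

theorem isQuotientMap_mk : IsQuotientMap (fun p : X × I => mk p.1 p.2) := isQuotientMap_quot_mk

@[fun_prop]
theorem continuous_mk {T : Type*} [TopologicalSpace T] {f : T → X} {s : T → I}
    (hf : Continuous f) (hs : Continuous s) : Continuous fun t => mk (f t) (s t) :=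
  isQuotientMap_mk.continuous.comp (hf.prodMk hs)

@[fun_prop]
theorem continuous_incl : Continuous (incl : X → Cone X) :=
  continuous_mk continuous_id continuous_const

@[fun_prop]
theorem continuous_height : Continuous (height : Cone X → I) :=
  continuous_quot_lift _ continuous_snd

theorem continuousOn_proj (x₀ : X) : ContinuousOn (proj x₀) {c : Cone X | height c ≠ 1} := by
  have ho : IsOpen {c : Cone X | height c ≠ 1} :=
    isOpen_ne.preimage (continuous_height (X := X))
  rw [isQuotientMap_mk.continuousOn_isOpen_iff ho]
  exact continuous_fst.continuousOn.congr fun p hp => proj_mk _ _ hp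

theorem isClosed_range_incl : IsClosed (range (incl : X → Cone X)) := by
  have : range (incl : X → Cone X) = height ⁻¹' {0} := by
    ext c; exact mem_range_incl
  rw [this]
  exact isClosed_singleton.preimage continuous_height

/-- Every point rises to the apex by time `1/2` and then descends along the segment over `x₀`. The
end is a point of the base rather than the apex, so that a coordinate that has been contracted lies
in the base again. -/
theorem exists_contraction (x₀ : X) : ∃ γ : Cone X × I → Cone X, Continuous γ ∧
    (∀ c, γ (c, 0) = c) ∧ ∀ c, γ (c, 1) = incl x₀ := by
  let γ : Cone X × I → Cone X := fun q => if (q.2 : ℝ) ≤ 1 / 2 then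
    mk (proj x₀ q.1) (max (height q.1) (clampI (2 * q.2))) else mk x₀ (clampI (2 - 2 * q.2))
  have key : ∀ (x : X) (s t : I), γ (mk x s, t) = if (t : ℝ) ≤ 1 / 2 then
      mk x (max s (clampI (2 * t))) else mk x₀ (clampI (2 - 2 * t)) := by
    intro x s t
    simp only [γ, height_mk]
    by_cases hs : s = 1
    · subst hs
      split_ifs
      · rw [max_eq_left le_one']; exact mk_one _ _
      · rfl
    · rw [proj_mk _ _ hs]
  refine ⟨γ, isQuotientMap_mk.continuous_lift_prod_left ?_, fun c => ?_, fun c => ?_⟩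
  · simp only [key]
    refine Continuous.if_le (by fun_prop) (by fun_prop) (by fun_prop) (by fun_prop) ?_
    intro p hp
    rw [hp]
    norm_num
    rw [max_eq_right le_one']
    exact mk_one _ _
  · obtain ⟨x, s, rfl⟩ := exists_eq_mk c
    rw [key]; simp
  · obtain ⟨x, s, rfl⟩ := exists_eq_mk c
    rw [key, if_neg (by norm_num)]; simp [incl_eq]

/-- A local contraction of the base of a cone induces one of the cone, preserving the base. -/
theorem exists_localContraction {x₀ : X} (L : LocalContraction x₀) :
    ∃ L' : LocalContraction (incl x₀), ∀ c t, height c = 0 → height (L'.map (c, t)) = 0 := by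
  -- Where `L` has height `h`, a point at cone height `s` is lowered by `min h (1 - s)`; the part of
  -- this amount exceeding `s` becomes the new height. If that excess is positive, the point has
  -- reached the base and `L` has reached `x₀`. The cutoff `1 - s` fixes the apex and makes both
  -- functions descend to the cone.
  let m : Cone X × I → Cone X := fun q => Quot.lift
    (fun p : X × I => mk (L.map (p.1, q.2))
      (clampI (p.2 - min (L.height (p.1, q.2) : ℝ) (1 - p.2))))
    (fun p p' h => by
      have : ∀ x : X, min (L.height (x, q.2) : ℝ) 0 = 0 := fun x =>
        min_eq_right (L.height (x, q.2)).2.1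
      simp only [h.1, h.2, Icc.coe_one, sub_self, this, sub_zero, clampI_one]
      exact mk_one _ _) q.1
  let v : Cone X × I → I := fun q => Quot.lift
    (fun p : X × I => clampI (min (L.height (p.1, q.2) : ℝ) (1 - p.2) - p.2))
    (fun p p' h => by
      have : ∀ x : X, min (L.height (x, q.2) : ℝ) 0 = 0 := fun x =>
        min_eq_right (L.height (x, q.2)).2.1
      simp only [h.1, h.2, Icc.coe_one, sub_self, this]) q.1
  have hm : ∀ x s t, m (mk x s, t) = mk (L.map (x, t))
    (clampI (s - min (L.height (x, t) : ℝ) (1 - s))) := fun _ _ _ => rfl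
  have hv : ∀ x s t, v (mk x s, t) = clampI (min (L.height (x, t) : ℝ) (1 - s) - s) :=
    fun _ _ _ => rfl
  have hLm := L.continuous_map
  have hLh := L.continuous_height
  refine ⟨⟨m, v, isQuotientMap_mk.continuous_lift_prod_left ?_,
    isQuotientMap_mk.continuous_lift_prod_left ?_, fun c => ?_, fun t => ?_, fun c => ?_, ?_,
    fun q hq => ?_⟩, fun c t hc => ?_⟩
  · simp only [hm]
    fun_prop
  · simp only [hv]
    fun_prop
  · obtain ⟨x, s, rfl⟩ := exists_eq_mk c
    rw [hm, L.map_zero, L.height_zero, Icc.coe_zero,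
      min_eq_left (by linarith [s.2.2] : (0 : ℝ) ≤ 1 - s)]
    simp
  · rw [incl_eq, hm, L.map_base, clampI_of_nonpos]
    simpa using (L.height (x₀, t)).2.1
  · obtain ⟨x, s, rfl⟩ := exists_eq_mk c
    rw [hv, L.height_zero, Icc.coe_zero, min_eq_left (by linarith [s.2.2] : (0 : ℝ) ≤ 1 - s)]
    exact clampI_of_nonpos (by linarith [s.2.1])
  · rw [incl_eq, hv, L.height_base]; simp
  · obtain ⟨c, t⟩ := q
    obtain ⟨x, s, rfl⟩ := exists_eq_mk c
    rw [hv, clampI_ne_zero] at hq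
    have h1 : 0 < (L.height (x, t) : ℝ) := by
      have := min_le_left (L.height (x, t) : ℝ) (1 - s)
      linarith [s.2.1]
    rw [hm, L.map_eq _ (fun h => by rw [h] at h1; simp at h1), clampI_of_nonpos (by linarith)]
    rfl
  · obtain ⟨x, s, rfl⟩ := exists_eq_mk c
    rw [height_mk] at hc
    subst hc
    change height (m (mk x 0, t)) = 0
    rw [hm, height_mk]
    refine clampI_of_nonpos ?_
    simpa using (L.height (x, t)).2.1

end Cone

/-! ### Local contractions of products and subspaces -/

namespace LocalContraction

/-- Local contractions of the factors of a finite product induce one of the product. -/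
def pi {ι : Type*} [Fintype ι] {Z : ι → Type*} [∀ i, TopologicalSpace (Z i)] {z : ∀ i, Z i}
    (L : ∀ i, LocalContraction (z i)) : LocalContraction z where
  map q i := (L i).map (q.1 i, q.2)
  -- The factor `q.2` makes the height vanish at time `0` even when the index set is empty and the
  -- product is `1`.
  height q := q.2 * ∏ i, (L i).height (q.1 i, q.2)
  continuous_map := continuous_pi fun i => (L i).continuous_map.comp (by fun_prop)
  continuous_height := continuous_snd.mul
    (continuous_finsetProd _ fun i _ => (L i).continuous_height.comp (by fun_prop))
  map_zero a := funext fun i => (L i).map_zero _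
  map_base t := funext fun i => (L i).map_base _
  height_zero a := zero_mul _
  height_base := by simp [height_base]
  map_eq q hq := funext fun i => (L i).map_eq _ fun h => hq <| by
    rw [Finset.prod_eq_zero (Finset.mem_univ i) h, mul_zero]

/-- A local contraction restricts to every invariant subspace. -/
def restrict {A : Type*} [TopologicalSpace A] {a₀ : A} (L : LocalContraction a₀) (S : Set A)
    (h₀ : a₀ ∈ S) (hS : ∀ a ∈ S, ∀ t, L.map (a, t) ∈ S) :
    LocalContraction (⟨a₀, h₀⟩ : S) where
  map q := ⟨L.map (q.1, q.2), hS _ q.1.2 _⟩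
  height q := L.height (q.1, q.2)
  continuous_map := (L.continuous_map.comp (by fun_prop)).subtype_mk _
  continuous_height := L.continuous_height.comp (by fun_prop)
  map_zero a := Subtype.ext (L.map_zero _)
  map_base t := Subtype.ext (L.map_base _)
  height_zero a := L.height_zero _
  height_base := L.height_base
  map_eq q hq := Subtype.ext (L.map_eq _ hq)

end LocalContraction

/-! ### Polyhedral products of cones -/

section ConePolyhedralProduct

variable {ι : Type*} {X : ι → Type*}

theorem mem_conePolyhedralPiece {F : Finset ι} {b : ∀ i, Cone (X i)} :
    b ∈ polyhedralPiece (fun i => range (Cone.incl : X i → Cone (X i))) F ↔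
      ∀ i, i ∉ F → (b i).height = 0 :=
  forall₂_congr fun _ _ => Cone.mem_range_incl

theorem mem_conePolyhedralProduct {K : PreAbstractSimplicialComplex ι} {b : ∀ i, Cone (X i)} :
    b ∈ conePolyhedralProduct X K ↔
      ∃ F, (F = ∅ ∨ F ∈ K) ∧ ∀ i, i ∉ F → (b i).height = 0 := by
  simp only [conePolyhedralProduct, polyhedralProduct, mem_iUnion, mem_ofPred_eq, exists_prop,
    mem_conePolyhedralPiece]

variable [∀ i, TopologicalSpace (X i)]

/-- The contractions of the cones keep base points in the base, so their product preserves the piece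
of every simplex and restricts to the polyhedral product. -/
theorem nonempty_localContraction_conePolyhedralProduct [Finite ι] {x₀ : ∀ i, X i}
    (L : ∀ i, LocalContraction (x₀ i)) (K : PreAbstractSimplicialComplex ι) :
    Nonempty (LocalContraction (conePolyhedralProduct.base x₀ K)) := by
  cases nonempty_fintype ι
  choose L' hL' using fun i => Cone.exists_localContraction (L i)
  refine ⟨(LocalContraction.pi L').restrict _ _ fun a ha t => ?_⟩
  obtain ⟨F, hF, h⟩ := mem_conePolyhedralProduct.1 ha
  exact mem_conePolyhedralProduct.2 ⟨F, hF, fun i hi => hL' i _ t (h i hi)⟩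

/-- Each piece deformation retracts onto the product of the factors which are not coned off. -/
theorem exists_deformation_conePolyhedralPiece (x₀ : ∀ i, X i) (F : Finset ι) :
    ∃ (r : polyhedralPiece (fun i => range (Cone.incl : X i → Cone (X i))) F →
          ∀ i : {i // i ∉ F}, X i)
      (s : (∀ i : {i // i ∉ F}, X i) →
          polyhedralPiece (fun i => range (Cone.incl : X i → Cone (X i))) F)
      (H : polyhedralPiece (fun i => range (Cone.incl : X i → Cone (X i))) F × I →
          polyhedralPiece (fun i => range (Cone.incl : X i → Cone (X i))) F),
      Continuous r ∧ Continuous s ∧ Continuous H ∧ (∀ p, r (s p) = p) ∧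
      (∀ b, H (b, 0) = b) ∧ ∀ b, H (b, 1) = s (r b) := by
  classical
  choose γ hγ hγ0 hγ1 using fun i => Cone.exists_contraction (x₀ i)
  have hval : ∀ i, Continuous fun b : polyhedralPiece
      (fun i => range (Cone.incl : X i → Cone (X i))) F => b.1 i :=
    fun i => (continuous_apply i).comp continuous_subtype_val
  refine ⟨fun b i => (b.1 i).proj (x₀ i),
    fun p => ⟨fun i => if h : i ∉ F then Cone.incl (p ⟨i, h⟩) else Cone.incl (x₀ i), ?_⟩,
    fun q => ⟨fun i => if i ∉ F then q.1.1 i else γ i (q.1.1 i, q.2), ?_⟩,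
    ?_, ?_, ?_, ?_, ?_, ?_⟩
  · rw [mem_conePolyhedralPiece]
    intro i hi
    simp only [dif_pos hi, Cone.height_incl]
  · rw [mem_conePolyhedralPiece]
    intro i hi
    simp only [if_pos hi]
    exact mem_conePolyhedralPiece.1 q.1.2 i hi
  · refine continuous_pi fun i => ?_
    refine (Cone.continuousOn_proj (x₀ i)).comp_continuous (hval i) fun b => ?_
    change (b.1 i).height ≠ 1
    rw [mem_conePolyhedralPiece.1 b.2 i i.2]
    exact zero_ne_one
  · refine Continuous.subtype_mk (continuous_pi fun i => ?_) _
    split_ifs <;> fun_prop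
  · refine Continuous.subtype_mk (continuous_pi fun i => ?_) _
    split_ifs
    · exact (hγ i).comp (((hval i).comp continuous_fst).prodMk continuous_snd)
    · exact (hval i).comp continuous_fst
  · intro p
    funext i
    simp only [dif_pos i.2, Cone.proj_incl]
  · intro b
    apply Subtype.ext
    funext i
    simp only [hγ0, ite_self]
  · intro b
    apply Subtype.ext
    funext i
    dsimp only
    split_ifs with hi
    · rw [hγ1]
    · exact (Cone.incl_proj _ (mem_conePolyhedralPiece.1 b.2 i hi)).symm

/-- If all vertices belong to `K`, then the piece of a simplex of `K` is null-homotopic in the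
polyhedral product: the coordinates are moved to the basepoint one after another. -/
theorem exists_nullhomotopy_conePolyhedralPiece {n : ℕ} {X : Fin n → Type*}
    [∀ i, TopologicalSpace (X i)] (x₀ : ∀ i, X i) {K : PreAbstractSimplicialComplex (Fin n)}
    (hK : ∀ i, {i} ∈ K) {F : Finset (Fin n)} (hF : F = ∅ ∨ F ∈ K) :
    ∃ H : polyhedralPiece (fun i => range (Cone.incl : X i → Cone (X i))) F × I →
        conePolyhedralProduct X K, Continuous H ∧ (∀ b, (H (b, 0)).1 = b.1) ∧
      ∀ b, H (b, 1) = conePolyhedralProduct.base x₀ K := by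
  classical
  choose γ hγ hγ0 hγ1 using fun i => Cone.exists_contraction (x₀ i)
  have hval : ∀ i, Continuous fun b : polyhedralPiece
      (fun i => range (Cone.incl : X i → Cone (X i))) F => b.1 i :=
    fun i => (continuous_apply i).comp continuous_subtype_val
  -- In the rescaled time `(n + 1) t`, coordinates in `F` move during `[0, 1]`, while the point
  -- stays in the piece of `F`. A coordinate `i ∉ F` moves during `[i + 1, i + 2]`; then all other
  -- coordinates are in the base, so the point is in the piece of the vertex `i`.
  let e : Fin n → ℝ := fun i => if i ∈ F then 0 else ((i : ℕ) : ℝ) + 1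
  have he0 : ∀ i, 0 ≤ e i := fun i => by
    simp only [e]; split_ifs <;> positivity
  refine ⟨fun q => ⟨fun i => γ i (q.1.1 i, clampI ((n + 1) * q.2 - e i)), ?_⟩, ?_, ?_, ?_⟩
  · rw [mem_conePolyhedralProduct]
    have hbase : ∀ i, i ∉ F → (q.1.1 i).height = 0 := mem_conePolyhedralPiece.1 q.1.2
    have hlow : ∀ i, i ∉ F → (n + 1) * (q.2 : ℝ) - e i ≤ 0 →
        (γ i (q.1.1 i, clampI ((n + 1) * q.2 - e i))).height = 0 := by
      intro i hi h
      rw [clampI_of_nonpos h, hγ0, hbase i hi]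
    have hhigh : ∀ i, 1 ≤ (n + 1) * (q.2 : ℝ) - e i →
        (γ i (q.1.1 i, clampI ((n + 1) * q.2 - e i))).height = 0 := by
      intro i h
      rw [clampI_of_one_le h, hγ1, Cone.height_incl]
    rcases le_total ((n + 1) * (q.2 : ℝ)) 1 with ht | ht
    · refine ⟨F, hF, fun i hi => hlow i hi ?_⟩
      simp only [e, if_neg hi]
      have : (0 : ℝ) ≤ (i : ℕ) := Nat.cast_nonneg _
      linarith
    · by_cases hj : ∃ j, j ∉ F ∧ 0 < (n + 1) * (q.2 : ℝ) - e j ∧ (n + 1) * (q.2 : ℝ) - e j < 1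
      · obtain ⟨j, hjF, hj0, hj1⟩ := hj
        refine ⟨{j}, Or.inr (hK j), fun i hi => ?_⟩
        rw [Finset.mem_singleton] at hi
        by_cases hiF : i ∈ F
        · apply hhigh
          simpa only [e, if_pos hiF, sub_zero] using ht
        · rcases lt_or_gt_of_ne (fun h => hi (Fin.ext h) : (i : ℕ) ≠ j) with h | h
          · apply hhigh
            have : ((i : ℕ) : ℝ) + 1 ≤ (j : ℕ) := by exact_mod_cast h
            simp only [e, if_neg hiF, if_neg hjF] at hj0 hj1 ⊢
            linarith
          · apply hlow i hiF
            have : ((j : ℕ) : ℝ) + 1 ≤ (i : ℕ) := by exact_mod_cast h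
            simp only [e, if_neg hiF, if_neg hjF] at hj0 hj1 ⊢
            linarith
      · push Not at hj
        refine ⟨∅, Or.inl rfl, fun i _ => ?_⟩
        by_cases hiF : i ∈ F
        · apply hhigh
          simpa only [e, if_pos hiF, sub_zero] using ht
        · rcases le_or_gt ((n + 1) * (q.2 : ℝ) - e i) 0 with h | h
          · exact hlow i hiF h
          · exact hhigh i (hj i hiF h)
  · refine Continuous.subtype_mk (continuous_pi fun i => ?_) _
    exact (hγ i).comp (((hval i).comp continuous_fst).prodMk (by fun_prop))
  · intro b
    funext i
    dsimp only
    rw [clampI_of_nonpos, hγ0]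
    simpa using he0 i
  · intro b
    apply Subtype.ext
    funext i
    dsimp only
    rw [clampI_of_one_le, hγ1]
    · rfl
    · have : ((i : ℕ) : ℝ) + 1 ≤ n := by exact_mod_cast i.2
      simp only [e, Icc.coe_one]
      split_ifs <;> linarith

end ConePolyhedralProduct

theorem ContinuousMap.Homotopic.of_continuous {A B : Type*} [TopologicalSpace A]
    [TopologicalSpace B] {f g : C(A, B)} (H : A × I → B) (hH : Continuous H)
    (h0 : ∀ a, H (a, 0) = f a) (h1 : ∀ a, H (a, 1) = g a) : f.Homotopic g :=
  ⟨{ toFun := fun q => H (q.2, q.1)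
     continuous_toFun := by fun_prop
     map_zero_left := h0
     map_one_left := h1 }⟩

/-! ### Joins -/

namespace Join

variable {A B : Type*}

/-- The point of the join with coordinates `(a, t, b)`. -/
def mk (a : A) (t : I) (b : B) : Join A B := Quot.mk _ (a, t, b)

theorem mk_zero (a : A) (b b' : B) : mk a 0 b = mk a 0 b' := Quot.sound (Or.inr ⟨rfl, rfl, rfl⟩)

theorem mk_one (a a' : A) (b : B) : mk a 1 b = mk a' 1 b := Quot.sound (Or.inl ⟨rfl, rfl, rfl⟩)

/-- Maps out of the join. -/
def lift {E : Type*} (f : A → I → B → E) (h0 : ∀ a b b', f a 0 b = f a 0 b')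
    (h1 : ∀ a a' b, f a 1 b = f a' 1 b) : Join A B → E :=
  Quot.lift (fun p => f p.1 p.2.1 p.2.2) <| by
    rintro ⟨a, t, b⟩ ⟨a', t', b'⟩ (⟨rfl, rfl, rfl⟩ | ⟨rfl, rfl, rfl⟩)
    exacts [h1 _ _ _, h0 _ _ _]

theorem exists_eq_mk (w : Join A B) : ∃ a t b, w = mk a t b := by
  induction w using Quot.ind with
  | mk p => exact ⟨p.1, p.2.1, p.2.2, rfl⟩

variable [TopologicalSpace A] [TopologicalSpace B]

theorem isQuotientMap_mk : IsQuotientMap (fun p : A × I × B => mk p.1 p.2.1 p.2.2) :=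
  isQuotientMap_quot_mk

@[fun_prop]
theorem continuous_mk {T : Type*} [TopologicalSpace T] {f : T → A} {s : T → I} {g : T → B}
    (hf : Continuous f) (hs : Continuous s) (hg : Continuous g) :
    Continuous fun t => mk (f t) (s t) (g t) :=
  isQuotientMap_mk.continuous.comp (hf.prodMk (hs.prodMk hg))

end Join

/-! ### Double mapping cylinders and their homotopy invariance -/

/-- The double mapping cylinder of `f : S → Y` and `g : S → Q`: the cylinder `S × I` is glued to
`Y` along `f` at time `1` and to `Q` along `g` at time `0`. -/
def DoubleCylinder {S Y Q : Type*} (f : S → Y) (g : S → Q) : Type _ :=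
  Quot (fun p q : Y ⊕ (S × I) ⊕ Q =>
    (∃ s, p = Sum.inr (Sum.inl (s, 1)) ∧ q = Sum.inl (f s)) ∨
      ∃ s, p = Sum.inr (Sum.inl (s, 0)) ∧ q = Sum.inr (Sum.inr (g s)))

namespace DoubleCylinder

variable {S Y Q : Type*} {f : S → Y} {g : S → Q}

instance [TopologicalSpace S] [TopologicalSpace Y] [TopologicalSpace Q] :
    TopologicalSpace (DoubleCylinder f g) :=
  inferInstanceAs (TopologicalSpace (Quot _))

/-- The inclusion of the end at time `1`. -/
def left (y : Y) : DoubleCylinder f g := Quot.mk _ (Sum.inl y)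

/-- The points of the cylinder. -/
def cyl (s : S) (r : I) : DoubleCylinder f g := Quot.mk _ (Sum.inr (Sum.inl (s, r)))

/-- The inclusion of the end at time `0`. -/
def right (q : Q) : DoubleCylinder f g := Quot.mk _ (Sum.inr (Sum.inr q))

theorem cyl_one (s : S) : (cyl s 1 : DoubleCylinder f g) = left (f s) :=
  Quot.sound (Or.inl ⟨s, rfl, rfl⟩)

theorem cyl_zero (s : S) : (cyl s 0 : DoubleCylinder f g) = right (g s) :=
  Quot.sound (Or.inr ⟨s, rfl, rfl⟩)

/-- Maps out of a double mapping cylinder. -/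
def lift {E : Type*} (a : Y → E) (b : S → I → E) (c : Q → E) (h1 : ∀ s, b s 1 = a (f s))
    (h0 : ∀ s, b s 0 = c (g s)) : DoubleCylinder f g → E :=
  Quot.lift (Sum.elim a (Sum.elim (fun p => b p.1 p.2) c)) <| by
    rintro _ _ (⟨s, rfl, rfl⟩ | ⟨s, rfl, rfl⟩)
    exacts [h1 s, h0 s]

theorem ind {p : DoubleCylinder f g → Prop} (hl : ∀ y, p (left y)) (hc : ∀ s r, p (cyl s r))
    (hr : ∀ q, p (right q)) (d : DoubleCylinder f g) : p d := by
  induction d using Quot.ind with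
  | mk x =>
    rcases x with y | ⟨s, r⟩ | q
    exacts [hl y, hc s r, hr q]

variable [TopologicalSpace S] [TopologicalSpace Y] [TopologicalSpace Q]

@[fun_prop]
theorem continuous_left : Continuous (left : Y → DoubleCylinder f g) :=
  continuous_quot_mk.comp continuous_inl

@[fun_prop]
theorem continuous_right : Continuous (right : Q → DoubleCylinder f g) :=
  continuous_quot_mk.comp (continuous_inr.comp continuous_inr)

@[fun_prop]
theorem continuous_cyl {T : Type*} [TopologicalSpace T] {s : T → S} {r : T → I}
    (hs : Continuous s) (hr : Continuous r) :
    Continuous fun t => (cyl (s t) (r t) : DoubleCylinder f g) :=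
  continuous_quot_mk.comp (continuous_inr.comp (continuous_inl.comp (hs.prodMk hr)))

theorem continuous_of {E : Type*} [TopologicalSpace E] {k : DoubleCylinder f g → E}
    (hl : Continuous fun y => k (left y)) (hc : Continuous fun p : S × I => k (cyl p.1 p.2))
    (hr : Continuous fun q => k (right q)) : Continuous k :=
  isQuotientMap_quot_mk.continuous_iff.2
    (continuous_sum_dom.2 ⟨hl, continuous_sum_dom.2 ⟨hc, hr⟩⟩)

/-- The product of a quotient map with a locally compact space is again a quotient map; used with `T
= I` to construct homotopies piecewise. -/
theorem continuous_prod_of {E T : Type*} [TopologicalSpace E] [TopologicalSpace T]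
    [LocallyCompactSpace T] {k : DoubleCylinder f g × T → E}
    (hl : Continuous fun p : Y × T => k (left p.1, p.2))
    (hc : Continuous fun p : (S × I) × T => k (cyl p.1.1 p.1.2, p.2))
    (hr : Continuous fun p : Q × T => k (right p.1, p.2)) : Continuous k := by
  refine isQuotientMap_quot_mk.continuous_lift_prod_left ?_
  rw [← Homeomorph.sumProdDistrib.symm.comp_continuous_iff']
  refine continuous_sum_dom.2 ⟨hl, ?_⟩
  change Continuous fun p : ((S × I) ⊕ Q) × T => k (Quot.mk _ (Sum.inr p.1), p.2)
  rw [← Homeomorph.sumProdDistrib.symm.comp_continuous_iff']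
  exact continuous_sum_dom.2 ⟨hc, hr⟩

/-- Reparametrizing the cylinder gives a map homotopic to the identity. -/
theorem homotopic_id_of_reparam {F : C(DoubleCylinder f g, DoubleCylinder f g)} {θ : I → I}
    (hθ : Continuous θ) (h0 : θ 0 = 0) (h1 : θ 1 = 1) (hl : ∀ y, F (left y) = left y)
    (hc : ∀ s r, F (cyl s r) = cyl s (θ r)) (hr : ∀ q, F (right q) = right q) :
    F.Homotopic (ContinuousMap.id _) := by
  let H : DoubleCylinder f g × I → DoubleCylinder f g := fun p =>
    lift left (fun s r => cyl s (clampI ((1 - p.2) * θ r + p.2 * r))) right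
      (fun s => by rw [h1]; simp [cyl_one]) (fun s => by rw [h0]; simp [cyl_zero]) p.1
  have Hl : ∀ y t, H (left y, t) = left y := fun _ _ => rfl
  have Hc : ∀ s r t, H (cyl s r, t) = cyl s (clampI ((1 - t) * θ r + t * r)) := fun _ _ _ => rfl
  have Hr : ∀ q t, H (right q, t) = right q := fun _ _ => rfl
  refine .of_continuous H (continuous_prod_of ?_ ?_ ?_) ?_ ?_
  · simp only [Hl]; fun_prop
  · simp only [Hc]; fun_prop
  · simp only [Hr]; fun_prop
  · refine ind ?_ ?_ ?_
    · intro y; rw [hl, Hl]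
    · intro s r; rw [hc, Hc]; simp
    · intro q; rw [hr, Hr]
  · refine ind ?_ ?_ ?_
    · intro y; rw [Hl]; rfl
    · intro s r; rw [Hc]; simp
    · intro q; rw [Hr]; rfl

section Homotopy

variable {f' : S → Y}

/-- The comparison map of double mapping cylinders induced by a homotopy of the left map. -/
theorem exists_map_of_homotopy {H : S × I → Y} (hH : Continuous H) (hH0 : ∀ s, H (s, 0) = f s)
    (hH1 : ∀ s, H (s, 1) = f' s) :
    ∃ Φ : C(DoubleCylinder f g, DoubleCylinder f' g), (∀ y, Φ (left y) = left y) ∧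
      (∀ q, Φ (right q) = right q) ∧
      ∀ s r, Φ (cyl s r) = if (r : ℝ) ≤ 1 / 2 then cyl s (clampI (2 * r)) else
        left (H (s, clampI (2 - 2 * r))) := by
  -- The lower half runs through the whole cylinder; the upper half follows `H` backwards inside
  -- `Y`, from `f' s` to `f s`.
  refine ⟨⟨lift left (fun s r => if (r : ℝ) ≤ 1 / 2 then cyl s (clampI (2 * r)) else
        left (H (s, clampI (2 - 2 * r)))) right ?_ ?_, continuous_of ?_ ?_ ?_⟩,
    fun _ => rfl, fun _ => rfl, fun _ _ => rfl⟩
  · intro s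
    rw [if_neg (by norm_num)]
    simp [hH0]
  · intro s
    rw [if_pos (by norm_num)]
    simp [cyl_zero]
  · exact continuous_left
  · change Continuous fun p : S × I => if (p.2 : ℝ) ≤ 1 / 2 then cyl p.1 (clampI (2 * p.2)) else
        left (H (p.1, clampI (2 - 2 * p.2)))
    refine Continuous.if_le (by fun_prop) (by fun_prop) (by fun_prop) (by fun_prop) ?_
    intro p hp
    rw [hp]
    norm_num
    rw [cyl_one, hH1]
  · exact continuous_right

/-- On a cylinder line the composite runs through the cylinder on `[0, 1/4]`, then traverses `H`
forwards on `[1/4, 1/2]` and backwards on `[1/2, 1]`. The excursion has parameter `min (2 - 2r) (4r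
- 1)`; scaling it to zero leaves a reparametrization of the cylinder. -/
theorem homotopic_id_of_homotopy {H H' : S × I → Y} (hH : Continuous H)
    (hH0 : ∀ s, H (s, 0) = f s) (hHH' : ∀ s t, H' (s, t) = H (s, σ t))
    {Φ : C(DoubleCylinder f g, DoubleCylinder f' g)}
    {Ψ : C(DoubleCylinder f' g, DoubleCylinder f g)}
    (hΦl : ∀ y, Φ (left y) = left y) (hΦr : ∀ q, Φ (right q) = right q)
    (hΦ : ∀ s r, Φ (cyl s r) = if (r : ℝ) ≤ 1 / 2 then cyl s (clampI (2 * r)) else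
        left (H (s, clampI (2 - 2 * r))))
    (hΨl : ∀ y, Ψ (left y) = left y) (hΨr : ∀ q, Ψ (right q) = right q)
    (hΨ : ∀ s r, Ψ (cyl s r) = if (r : ℝ) ≤ 1 / 2 then cyl s (clampI (2 * r)) else
        left (H' (s, clampI (2 - 2 * r)))) :
    (Ψ.comp Φ).Homotopic (ContinuousMap.id _) := by
  let K : DoubleCylinder f g × I → DoubleCylinder f g := fun p =>
    lift left (fun s r => if (r : ℝ) ≤ 1 / 4 then cyl s (clampI (4 * r)) else
        left (H (s, clampI ((1 - p.2) * min (2 - 2 * (r : ℝ)) (4 * r - 1))))) right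
      (fun s => by rw [if_neg (by norm_num)]; norm_num [hH0])
      (fun s => by rw [if_pos (by norm_num)]; simp [cyl_zero]) p.1
  have Kl : ∀ y t, K (left y, t) = left y := fun _ _ => rfl
  have Kc : ∀ s r t, K (cyl s r, t) = if (r : ℝ) ≤ 1 / 4 then cyl s (clampI (4 * r)) else
        left (H (s, clampI ((1 - t) * min (2 - 2 * (r : ℝ)) (4 * r - 1)))) := fun _ _ _ => rfl
  have Kr : ∀ q t, K (right q, t) = right q := fun _ _ => rfl
  have hK : Continuous K := by
    refine continuous_prod_of ?_ ?_ ?_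
    · simp only [Kl]; fun_prop
    · simp only [Kc]
      refine Continuous.if_le (by fun_prop) (by fun_prop) (by fun_prop) (by fun_prop) ?_
      intro p hp
      rw [hp]
      norm_num
      rw [cyl_one, hH0]
    · simp only [Kr]; fun_prop
  let K₁ : C(DoubleCylinder f g, DoubleCylinder f g) := ⟨fun d => K (d, 1), by fun_prop⟩
  refine (ContinuousMap.Homotopic.of_continuous (g := K₁) K hK ?_ fun _ => rfl).trans
    (homotopic_id_of_reparam (θ := fun r => clampI (4 * r)) (by fun_prop) (by simp)
      (clampI_of_one_le (by norm_num)) (fun y => rfl) ?_ (fun q => rfl))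
  · refine ind ?_ ?_ ?_
    · intro y; rw [ContinuousMap.comp_apply, hΦl, hΨl, Kl]
    · intro s r
      rw [ContinuousMap.comp_apply, hΦ, Kc]
      by_cases h2 : (r : ℝ) ≤ 1 / 2
      · rw [if_pos h2, hΨ, coe_clampI (by linarith [r.2.1]) (by linarith)]
        by_cases h4 : (r : ℝ) ≤ 1 / 4
        · rw [if_pos h4, if_pos (by linarith)]
          congr 2; ring
        · rw [if_neg h4, if_neg (by linarith), hHH', min_eq_right (by linarith)]
          congr 3
          apply Subtype.ext
          simp only [Icc.coe_zero, sub_zero, one_mul]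
          rw [coe_symm_eq, coe_clampI (by linarith) (by linarith),
            coe_clampI (by linarith) (by linarith)]
          ring
      · rw [if_neg h2, if_neg (by linarith), hΨl, min_eq_left (by linarith)]
        simp
    · intro q; rw [ContinuousMap.comp_apply, hΦr, hΨr, Kr]
  · intro s r
    change K (cyl s r, 1) = _
    rw [Kc]
    split_ifs with h
    · rfl
    · rw [clampI_of_one_le (by linarith : (1 : ℝ) ≤ 4 * r), cyl_one]
      simp [hH0]

/-- The homotopy type of a double mapping cylinder depends only on the homotopy class of the left
map. -/
theorem nonempty_homotopyEquiv_of_homotopy {H : S × I → Y} (hH : Continuous H)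
    (hH0 : ∀ s, H (s, 0) = f s) (hH1 : ∀ s, H (s, 1) = f' s) :
    Nonempty (ContinuousMap.HomotopyEquiv (DoubleCylinder f g) (DoubleCylinder f' g)) := by
  let H' : S × I → Y := fun p => H (p.1, σ p.2)
  have hH' : Continuous H' := by fun_prop
  obtain ⟨Φ, hΦl, hΦr, hΦ⟩ := exists_map_of_homotopy (g := g) hH hH0 hH1
  obtain ⟨Ψ, hΨl, hΨr, hΨ⟩ := exists_map_of_homotopy (f := f') (f' := f) (g := g) hH'
    (by simp [H', hH1]) (by simp [H', hH0])
  exact ⟨⟨Φ, Ψ, homotopic_id_of_homotopy hH hH0 (fun _ _ => rfl) hΦl hΦr hΦ hΨl hΨr hΨ,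
    homotopic_id_of_homotopy hH' (by simp [H', hH1]) (by simp [H']) hΨl hΨr hΨ hΦl hΦr hΦ⟩⟩

end Homotopy

end DoubleCylinder

/-! ### Replacing the base, and splitting off the join -/

namespace DoubleCylinder

/-- A double mapping cylinder on `B × X` whose left map factors through `X` depends, up to
homotopy equivalence, only on the homotopy type of `B`. -/
theorem nonempty_homotopyEquiv_of_deformation {B P X Y : Type*} [TopologicalSpace B]
    [TopologicalSpace P] [TopologicalSpace X] [TopologicalSpace Y] (F : X → Y)
    {r : B → P} {s : P → B} {H : B × I → B} (hr : Continuous r) (hs : Continuous s)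
    (hH : Continuous H) (hrs : ∀ p, r (s p) = p) (hH0 : ∀ b, H (b, 0) = b)
    (hH1 : ∀ b, H (b, 1) = s (r b)) :
    Nonempty (ContinuousMap.HomotopyEquiv
      (DoubleCylinder (fun q : B × X => F q.2) (Prod.fst : B × X → B))
      (DoubleCylinder (fun q : P × X => F q.2) (Prod.fst : P × X → P))) := by
  let Φ : C(DoubleCylinder (fun q : B × X => F q.2) (Prod.fst : B × X → B),
      DoubleCylinder (fun q : P × X => F q.2) (Prod.fst : P × X → P)) :=
    ⟨lift left (fun q t => cyl (r q.1, q.2) t) (fun b => right (r b))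
      (fun _ => cyl_one _) (fun _ => cyl_zero _), by
      refine continuous_of continuous_left ?_ (continuous_right.comp hr)
      change Continuous fun p : (B × X) × I => cyl (r p.1.1, p.1.2) p.2
      fun_prop⟩
  let Ψ : C(DoubleCylinder (fun q : P × X => F q.2) (Prod.fst : P × X → P),
      DoubleCylinder (fun q : B × X => F q.2) (Prod.fst : B × X → B)) :=
    ⟨lift left (fun q t => cyl (s q.1, q.2) t) (fun b => right (s b))
      (fun _ => cyl_one _) (fun _ => cyl_zero _), by
      refine continuous_of continuous_left ?_ (continuous_right.comp hs)
      change Continuous fun p : (P × X) × I => cyl (s p.1.1, p.1.2) p.2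
      fun_prop⟩
  refine ⟨⟨Φ, Ψ, ContinuousMap.Homotopic.symm ?_, ?_⟩⟩
  · let K : DoubleCylinder (fun q : B × X => F q.2) (Prod.fst : B × X → B) × I →
        DoubleCylinder (fun q : B × X => F q.2) (Prod.fst : B × X → B) := fun p =>
      lift left (fun (q : B × X) t => cyl (H (q.1, p.2), q.2) t) (fun b => right (H (b, p.2)))
        (fun _ => cyl_one _) (fun _ => cyl_zero _) p.1
    have Kl : ∀ y t, K (left y, t) = left y := fun _ _ => rfl
    have Kc : ∀ b r t, K (cyl b r, t) = cyl (H (b.1, t), b.2) r := fun _ _ _ => rfl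
    have Kr : ∀ q t, K (right q, t) = right (H (q, t)) := fun _ _ => rfl
    refine .of_continuous K (continuous_prod_of ?_ ?_ ?_) ?_ ?_
    · simp only [Kl]; fun_prop
    · simp only [Kc]; fun_prop
    · simp only [Kr]; fun_prop
    · refine ind (fun y => rfl) (fun b t => ?_) (fun b => ?_)
      · rw [Kc, hH0]; rfl
      · rw [Kr, hH0]; rfl
    · refine ind (fun y => rfl) (fun b t => ?_) (fun b => ?_)
      · rw [Kc, hH1]; rfl
      · rw [Kr, hH1]; rfl
  · have : Φ.comp Ψ = ContinuousMap.id _ := by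
      refine ContinuousMap.ext (ind (fun y => rfl) (fun b t => ?_) (fun b => ?_))
      · change cyl (r (s b.1), b.2) t = _
        rw [hrs]; rfl
      · change right (r (s b)) = _
        rw [hrs]; rfl
    rw [this]

/-- The double mapping cylinder of `P × X → X → Y` and the projection `P × X → P` is obtained
from the join of `P` and `X` by gluing a cylinder to its end `X`. -/
theorem nonempty_homotopyEquiv_join {P X Y : Type*} [TopologicalSpace P] [TopologicalSpace X]
    [TopologicalSpace Y] {F : X → Y} (hF : Continuous F) (p₀ : P) (x₀ : X) :
    Nonempty (ContinuousMap.HomotopyEquiv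
      (DoubleCylinder (fun q : P × X => F q.2) (Prod.fst : P × X → P))
      (DoubleCylinder (fun x : X => Join.mk p₀ 1 x) F)) := by
  -- The cylinder is cut at time `1/2`: the half next to `P` becomes the join, and the half next to
  -- `Y` is projected to the cylinder on `X`. The inverse collapses that cylinder onto `Y`.
  let Φ : C(DoubleCylinder (fun q : P × X => F q.2) (Prod.fst : P × X → P),
      DoubleCylinder (fun x : X => Join.mk p₀ 1 x) F) :=
    ⟨lift right (fun q t => if (t : ℝ) ≤ 1 / 2 then left (Join.mk q.1 (clampI (2 * t)) q.2)
        else cyl q.2 (clampI (2 - 2 * t))) (fun p => left (Join.mk p 0 x₀))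
      (fun q => by rw [if_neg (by norm_num)]; simp [cyl_zero])
      (fun q => by
        rw [if_pos (by norm_num)]
        simp only [Icc.coe_zero, mul_zero, clampI_zero]
        rw [Join.mk_zero]), by
      refine continuous_of continuous_right ?_ ?_
      · change Continuous fun q : (P × X) × I => if (q.2 : ℝ) ≤ 1 / 2 then
          left (Join.mk q.1.1 (clampI (2 * q.2)) q.1.2) else cyl q.1.2 (clampI (2 - 2 * q.2))
        refine Continuous.if_le (by fun_prop) (by fun_prop) (by fun_prop) (by fun_prop) ?_
        intro q hq
        rw [hq]
        norm_num
        rw [cyl_one, Join.mk_one]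
      · exact continuous_left.comp (by fun_prop)⟩
  let Ψ : C(DoubleCylinder (fun x : X => Join.mk p₀ 1 x) F,
      DoubleCylinder (fun q : P × X => F q.2) (Prod.fst : P × X → P)) :=
    ⟨lift (Join.lift (fun p t x => cyl (p, x) t) (fun _ _ _ => by rw [cyl_zero, cyl_zero])
        (fun _ _ _ => by rw [cyl_one, cyl_one])) (fun x _ => left (F x)) left
      (fun x => (cyl_one (p₀, x)).symm) (fun _ => rfl), by
      refine continuous_of ?_ ?_ continuous_left
      · refine Join.isQuotientMap_mk.continuous_iff.2 ?_
        change Continuous fun q : P × I × X => cyl (q.1, q.2.2) q.2.1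
        fun_prop
      · change Continuous fun q : X × I => left (F q.1)
        fun_prop⟩
  have hΨl : ∀ p t x, Ψ (left (Join.mk p t x)) = cyl (p, x) t := fun _ _ _ => rfl
  have hΨc : ∀ x t, Ψ (cyl x t) = left (F x) := fun _ _ => rfl
  have hΦc : ∀ q t, Φ (cyl q t) = if (t : ℝ) ≤ 1 / 2 then
    left (Join.mk q.1 (clampI (2 * t)) q.2) else cyl q.2 (clampI (2 - 2 * t)) := fun _ _ => rfl
  refine ⟨⟨Φ, Ψ, ?_, ContinuousMap.Homotopic.symm ?_⟩⟩
  · refine homotopic_id_of_reparam (θ := fun t => clampI (2 * t)) (by fun_prop) (by simp)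
      (clampI_of_one_le (by norm_num)) (fun y => rfl) (fun q t => ?_) (fun p => ?_)
    · rw [ContinuousMap.comp_apply, hΦc]
      split_ifs with h
      · rfl
      · rw [hΨc, clampI_of_one_le (by linarith), cyl_one]
    · exact cyl_zero (p, x₀)
  · let K : DoubleCylinder (fun x : X => Join.mk p₀ 1 x) F × I →
        DoubleCylinder (fun x : X => Join.mk p₀ 1 x) F := fun q =>
      lift (Join.lift (fun p t x => if (t : ℝ) * (1 + q.2) ≤ 1 then
            left (Join.mk p (clampI (t * (1 + q.2))) x) else cyl x (clampI (2 - t * (1 + q.2))))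
          (fun p x x' => by simp [Join.mk_zero p x x'])
          (fun p p' x => by
            simp only [Icc.coe_one, one_mul]
            split_ifs with h
            · have : q.2 = 0 := Subtype.ext (le_antisymm (by simpa using h) q.2.2.1)
              simp [this, Join.mk_one p p' x]
            · rfl))
        (fun x t => cyl x (clampI (t * (1 - q.2)))) right
        (fun x => by
          change cyl x (clampI ((1 : I) * (1 - q.2))) = if ((1 : I) : ℝ) * (1 + q.2) ≤ 1 then
            left (Join.mk p₀ (clampI ((1 : I) * (1 + q.2))) x) else
            cyl x (clampI (2 - (1 : I) * (1 + q.2)))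
          simp only [Icc.coe_one, one_mul]
          split_ifs with h
          · have : q.2 = 0 := Subtype.ext (le_antisymm (by simpa using h) q.2.2.1)
            simp [this, cyl_one]
          · congr 2; ring)
        (fun x => by simp [cyl_zero]) q.1
    have Kl : ∀ p t x u, K (left (Join.mk p t x), u) = if (t : ℝ) * (1 + u) ≤ 1 then
            left (Join.mk p (clampI (t * (1 + u))) x) else cyl x (clampI (2 - t * (1 + u))) :=
      fun _ _ _ _ => rfl
    have Kc : ∀ x t u, K (cyl x t, u) = cyl x (clampI (t * (1 - u))) := fun _ _ _ => rfl
    have Kr : ∀ y u, K (right y, u) = right y := fun _ _ => rfl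
    refine .of_continuous K (continuous_prod_of ?_ ?_ ?_) ?_ ?_
    · refine Join.isQuotientMap_mk.continuous_lift_prod_left ?_
      simp only [Kl]
      refine Continuous.if_le (by fun_prop) (by fun_prop) (by fun_prop) (by fun_prop) ?_
      intro q hq
      rw [hq]
      norm_num
      rw [cyl_one, Join.mk_one]
    · simp only [Kc]; fun_prop
    · simp only [Kr]; fun_prop
    · refine ind (fun w => ?_) (fun x t => ?_) (fun y => rfl)
      · obtain ⟨p, t, x, rfl⟩ := Join.exists_eq_mk w
        rw [Kl, if_pos (by simpa using t.2.2)]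
        simp
      · rw [Kc]; simp
    · refine ind (fun w => ?_) (fun x t => ?_) (fun y => rfl)
      · obtain ⟨p, t, x, rfl⟩ := Join.exists_eq_mk w
        rw [Kl, ContinuousMap.comp_apply, hΨl, hΦc]
        simp only [Icc.coe_one]
        have h : (t : ℝ) * (1 + 1) = 2 * t := by ring
        rw [h]
        by_cases h2 : (t : ℝ) ≤ 1 / 2
        · rw [if_pos h2, if_pos (by linarith)]
        · rw [if_neg h2, if_neg (by linarith)]
      · rw [Kc, ContinuousMap.comp_apply, hΨc]
        simp only [Icc.coe_one, sub_self, mul_zero, clampI_zero]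
        rw [cyl_zero]; rfl

end DoubleCylinder

/-! ### Half-smashes and wedges -/

namespace HalfSmash

variable {A B : Type*} {a₀ : A}

/-- The class of `(a, b)` in the half-smash. -/
def mk (a : A) (b : B) : HalfSmash a₀ B := Quot.mk _ (a, b)

theorem mk_base (b b' : B) : (mk a₀ b : HalfSmash a₀ B) = mk a₀ b' := Quot.sound ⟨rfl, rfl⟩

/-- Maps out of the half-smash. -/
def lift {E : Type*} (f : A → B → E) (h : ∀ b b', f a₀ b = f a₀ b') : HalfSmash a₀ B → E :=
  Quot.lift (fun p => f p.1 p.2) <| by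
    rintro ⟨a, b⟩ ⟨a', b'⟩ ⟨rfl, rfl⟩
    exact h _ _

theorem exists_eq_mk (w : HalfSmash a₀ B) : ∃ a b, w = mk a b := by
  induction w using Quot.ind with
  | mk p => exact ⟨p.1, p.2, rfl⟩

variable [TopologicalSpace A] [TopologicalSpace B]

theorem isQuotientMap_mk : IsQuotientMap (fun p : A × B => (mk p.1 p.2 : HalfSmash a₀ B)) :=
  isQuotientMap_quot_mk

@[fun_prop]
theorem continuous_mk {T : Type*} [TopologicalSpace T] {f : T → A} {g : T → B}
    (hf : Continuous f) (hg : Continuous g) :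
    Continuous fun t => (mk (f t) (g t) : HalfSmash a₀ B) :=
  isQuotientMap_mk.continuous.comp (hf.prodMk hg)

end HalfSmash

namespace Wedge

variable {A B : Type*} {a₀ : A} {b₀ : B}

/-- The inclusion of the first summand. -/
def inl (a : A) : Wedge a₀ b₀ := Quot.mk _ (Sum.inl a)

/-- The inclusion of the second summand. -/
def inr (b : B) : Wedge a₀ b₀ := Quot.mk _ (Sum.inr b)

theorem inl_eq_inr : (inl a₀ : Wedge a₀ b₀) = inr b₀ := Quot.sound ⟨rfl, rfl⟩

/-- Maps out of the wedge. -/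
def lift {E : Type*} (f : A → E) (g : B → E) (h : f a₀ = g b₀) : Wedge a₀ b₀ → E :=
  Quot.lift (Sum.elim f g) <| by
    rintro _ _ ⟨rfl, rfl⟩
    exact h

theorem ind {p : Wedge a₀ b₀ → Prop} (hl : ∀ a, p (inl a)) (hr : ∀ b, p (inr b))
    (w : Wedge a₀ b₀) : p w := by
  induction w using Quot.ind with
  | mk x =>
    rcases x with a | b
    exacts [hl a, hr b]

variable [TopologicalSpace A] [TopologicalSpace B]

@[fun_prop]
theorem continuous_inl : Continuous (inl : A → Wedge a₀ b₀) :=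
  continuous_quot_mk.comp _root_.continuous_inl

@[fun_prop]
theorem continuous_inr : Continuous (inr : B → Wedge a₀ b₀) :=
  continuous_quot_mk.comp _root_.continuous_inr

theorem continuous_of {E : Type*} [TopologicalSpace E] {k : Wedge a₀ b₀ → E}
    (hl : Continuous fun a => k (inl a)) (hr : Continuous fun b => k (inr b)) : Continuous k :=
  isQuotientMap_quot_mk.continuous_iff.2 (continuous_sum_dom.2 ⟨hl, hr⟩)

theorem continuous_prod_of {E T : Type*} [TopologicalSpace E] [TopologicalSpace T]
    [LocallyCompactSpace T] {k : Wedge a₀ b₀ × T → E}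
    (hl : Continuous fun p : A × T => k (inl p.1, p.2))
    (hr : Continuous fun p : B × T => k (inr p.1, p.2)) : Continuous k := by
  refine isQuotientMap_quot_mk.continuous_lift_prod_left ?_
  rw [← Homeomorph.sumProdDistrib.symm.comp_continuous_iff']
  exact continuous_sum_dom.2 ⟨hl, hr⟩

end Wedge

/-! ### From the cylinder to the wedge -/

namespace DoubleCylinder

/-- Gluing a cylinder on `X` between the basepoint of `W` and the subspace `{a₀} × X` of `A × X`
gives the wedge of `W` and the half-smash, if `a₀` has a local contraction. -/
theorem nonempty_homotopyEquiv_wedge {W A X : Type*} [TopologicalSpace W] [TopologicalSpace A]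
    [TopologicalSpace X] (w₀ : W) {a₀ : A} (L : LocalContraction a₀) (x₀ : X) :
    Nonempty (ContinuousMap.HomotopyEquiv
      (DoubleCylinder (fun _ : X => w₀) (fun x : X => (a₀, x)))
      (Wedge w₀ (HalfSmash.base a₀ x₀))) := by
  have hLm := L.continuous_map
  have hLh := L.continuous_height
  let D := DoubleCylinder (fun _ : X => w₀) (fun x : X => (a₀, x))
  let V := Wedge w₀ (HalfSmash.base a₀ x₀)
  have hV : ∀ x : X, (Wedge.inr (HalfSmash.mk a₀ x) : V) = Wedge.inl w₀ := fun x =>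
    (congrArg Wedge.inr (HalfSmash.mk_base x x₀)).trans Wedge.inl_eq_inr.symm
  -- This homotopy drags a neighbourhood of `{a₀} × X` along the cylinder, using heights above `1/2`
  -- as the cylinder coordinate. At time `1` it sends `{a₀} × X` to the single point `w₀`, so it
  -- descends to the half-smash.
  let k : (A × X) × I → D := fun q => if (L.height (q.1.1, q.2) : ℝ) ≤ 1 / 2 then
    right (L.map (q.1.1, q.2), q.1.2) else cyl q.1.2 (clampI (2 * L.height (q.1.1, q.2) - 1))
  have hk : Continuous k := by
    refine Continuous.if_le (by fun_prop) (by fun_prop) (by fun_prop) (by fun_prop) ?_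
    intro q hq
    have : L.map (q.1.1, q.2) = a₀ := L.map_eq _ fun h => by rw [h] at hq; norm_num at hq
    rw [this, hq]
    norm_num
    rw [cyl_zero]
  have hk0 : ∀ y, k (y, 0) = right y := fun y => by
    simp only [k]
    rw [L.height_zero, if_pos (by norm_num), L.map_zero]
  have hkb : ∀ x t, k ((a₀, x), t) = cyl x (clampI (2 * L.height (a₀, t) - 1)) := fun x t => by
    simp only [k]
    split_ifs with h
    · rw [L.map_base, clampI_of_nonpos (by linarith), cyl_zero]
    · rfl
  have hkb1 : ∀ x, k ((a₀, x), 1) = left w₀ := fun x => by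
    rw [hkb, L.height_base, clampI_of_one_le (by norm_num), cyl_one]
  let Φ : C(D, V) := ⟨lift Wedge.inl (fun _ _ => Wedge.inl w₀)
    (fun y => Wedge.inr (HalfSmash.mk y.1 y.2)) (fun _ => rfl) (fun x => (hV x).symm), by
      refine continuous_of Wedge.continuous_inl continuous_const ?_
      exact Wedge.continuous_inr.comp (by fun_prop)⟩
  let Ψ : C(V, D) := ⟨Wedge.lift left (HalfSmash.lift (fun a x => k ((a, x), 1))
      (fun x x' => by rw [hkb1, hkb1])) (hkb1 x₀).symm, by
    refine Wedge.continuous_of continuous_left ?_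
    refine HalfSmash.isQuotientMap_mk.continuous_iff.2 ?_
    change Continuous fun q : A × X => k ((q.1, q.2), 1)
    fun_prop⟩
  have hΨr : ∀ a x, Ψ (Wedge.inr (HalfSmash.mk a x)) = k ((a, x), 1) := fun _ _ => rfl
  refine ⟨⟨Φ, Ψ, ContinuousMap.Homotopic.symm ?_, ContinuousMap.Homotopic.symm ?_⟩⟩
  -- `k` is extended over the cylinder by raising every coordinate at least to the level reached by
  -- `(a₀, x)`; this agrees with `k` at one end and fixes the other.
  · let K : D × I → D := fun q => lift left
      (fun x r => cyl x (max r (clampI (2 * L.height (a₀, q.2) - 1)))) (fun y => k (y, q.2))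
      (fun x => by rw [max_eq_left le_one', cyl_one])
      (fun x => by rw [max_eq_right nonneg', hkb]) q.1
    have Kl : ∀ w t, K (left w, t) = left w := fun _ _ => rfl
    have Kc : ∀ x r t, K (cyl x r, t) = cyl x (max r (clampI (2 * L.height (a₀, t) - 1))) :=
      fun _ _ _ => rfl
    have Kr : ∀ y t, K (right y, t) = k (y, t) := fun _ _ => rfl
    refine .of_continuous K (continuous_prod_of ?_ ?_ ?_) ?_ ?_
    · simp only [Kl]; fun_prop
    · simp only [Kc]; fun_prop
    · simp only [Kr]; fun_prop
    · refine ind (fun w => rfl) (fun x r => ?_) (fun y => ?_)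
      · rw [Kc, L.height_zero, clampI_of_nonpos (by norm_num), max_eq_left nonneg']; rfl
      · rw [Kr, hk0]; rfl
    · refine ind (fun w => rfl) (fun x r => ?_) (fun y => ?_)
      · rw [Kc, L.height_base, clampI_of_one_le (by norm_num), max_eq_right le_one', cyl_one]; rfl
      · rfl
  · let K : V × I → V := fun q => Wedge.lift Wedge.inl
      (HalfSmash.lift (fun a x => Wedge.inr (HalfSmash.mk (L.map (a, q.2)) x))
        (fun x x' => by rw [L.map_base, HalfSmash.mk_base]))
      (by
        change _ = Wedge.inr (HalfSmash.mk (L.map (a₀, q.2)) x₀)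
        rw [L.map_base, hV]) q.1
    have Kl : ∀ w t, K (Wedge.inl w, t) = Wedge.inl w := fun _ _ => rfl
    have Kr : ∀ a x t, K (Wedge.inr (HalfSmash.mk a x), t) =
      Wedge.inr (HalfSmash.mk (L.map (a, t)) x) := fun _ _ _ => rfl
    refine .of_continuous K (Wedge.continuous_prod_of ?_ ?_) ?_ ?_
    · simp only [Kl]; fun_prop
    · refine HalfSmash.isQuotientMap_mk.continuous_lift_prod_left ?_
      simp only [Kr]
      exact Wedge.continuous_inr.comp (by fun_prop)
    · refine Wedge.ind (fun w => rfl) (fun b => ?_)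
      obtain ⟨a, x, rfl⟩ := HalfSmash.exists_eq_mk b
      rw [Kr, L.map_zero]; rfl
    · refine Wedge.ind (fun w => rfl) (fun b => ?_)
      obtain ⟨a, x, rfl⟩ := HalfSmash.exists_eq_mk b
      rw [Kr, ContinuousMap.comp_apply, hΨr]
      simp only [k]
      split_ifs with h
      · rfl
      · rw [L.map_eq (a, 1) (fun h0 => h (by rw [h0]; norm_num)), hV]; rfl

end DoubleCylinder

/-! ### The union of `A × X` and `B × CX` -/

/-- The subspace `A × X ∪ B × CX` of `A × CX`. -/
def coneUnion {A : Type*} (B : Set A) (X : Type*) : Set (A × Cone X) :=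
  {z | z.2.height = 0 ∨ z.1 ∈ B}

open DoubleCylinder in
/-- The union `A × X ∪ B × CX` is a double mapping cylinder. -/
theorem nonempty_homotopyEquiv_coneUnion {A X : Type*} [TopologicalSpace A] [TopologicalSpace X]
    {B : Set A} (hB : IsClosed B) (x₀ : X) :
    Nonempty (ContinuousMap.HomotopyEquiv (coneUnion B X)
      (DoubleCylinder (fun q : B × X => ((q.1 : A), q.2)) (Prod.fst : B × X → B))) := by
  classical
  let D := DoubleCylinder (fun q : B × X => ((q.1 : A), q.2)) (Prod.fst : B × X → B)
  let Φ : C(D, coneUnion B X) := ⟨lift (fun y => ⟨(y.1, Cone.incl y.2), Or.inl rfl⟩)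
    (fun q r => ⟨(q.1, Cone.mk q.2 (σ r)), Or.inr q.1.2⟩)
    (fun b => ⟨(b, Cone.mk x₀ 1), Or.inr b.2⟩)
    (fun q => by simp only [symm_one]; rfl)
    (fun q => Subtype.ext (Prod.ext rfl ((congrArg (Cone.mk q.2) symm_zero).trans
      (Cone.mk_one _ _)))), by
      refine continuous_of ?_ ?_ ?_
      · exact Continuous.subtype_mk (by fun_prop) _
      · exact Continuous.subtype_mk (f := fun q : (B × X) × I =>
          ((q.1.1 : A), Cone.mk q.1.2 (σ q.2))) (by fun_prop) _
      · exact Continuous.subtype_mk (by fun_prop) _⟩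
  -- Sending all heights from `1/2` on to `B` avoids `proj` near the apex, where it need not be
  -- continuous. The price is a homotopy equivalence that stretches the cone coordinate by `2`,
  -- instead of a homeomorphism between a subspace of a product and a quotient.
  let k : B × Cone X → D := fun q => if (q.2.height : ℝ) ≤ 1 / 2 then
    cyl (q.1, q.2.proj x₀) (clampI (1 - 2 * q.2.height)) else right q.1
  have hkle : ∀ b x (s : I), (s : ℝ) ≤ 1 / 2 → k (b, Cone.mk x s) = cyl (b, x) (clampI (1 - 2 * s)) := by
    intro b x s hs
    refine (if_pos hs).trans ?_
    rw [Cone.height_mk, Cone.proj_mk _ _ (fun h1 => by rw [h1] at hs; norm_num at hs)]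
  have hkgt : ∀ b x (s : I), ¬ (s : ℝ) ≤ 1 / 2 → k (b, Cone.mk x s) = right b :=
    fun b x s hs => if_neg hs
  have hproj : ContinuousOn (fun q : B × Cone X => q.2.proj x₀) {q | (q.2.height : ℝ) ≤ 1 / 2} := by
    refine (Cone.continuousOn_proj x₀).comp continuousOn_snd fun q hq h => ?_
    have : (q.2.height : ℝ) ≤ 1 / 2 := hq
    rw [h] at this
    norm_num at this
  have hk : Continuous k := by
    refine continuous_if_le (by fun_prop) (by fun_prop) ?_ (by fun_prop) ?_
    · have hc : Continuous fun p : (B × X) × I => (cyl p.1 p.2 : D) := by fun_prop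
      exact hc.comp_continuousOn ((continuousOn_fst.prodMk hproj).prodMk (by fun_prop))
    · intro q hq
      rw [hq]
      norm_num
      rw [cyl_zero]
  have hk0 : ∀ b c, Cone.height c = 0 → k (b, c) = left ((b : A), c.proj x₀) := by
    intro b c hc
    simp only [k, hc]
    rw [if_pos (by norm_num)]
    simp [cyl_one]
  let ψ : coneUnion B X → D := fun z => if h : z.1.1 ∈ B then k (⟨z.1.1, h⟩, z.1.2) else
    left (z.1.1, z.1.2.proj x₀)
  have hψB : ∀ z : coneUnion B X, ∀ h : z.1.1 ∈ B, ψ z = k (⟨z.1.1, h⟩, z.1.2) :=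
    fun z h => dif_pos h
  have hψ0 : ∀ z : coneUnion B X, z.1.2.height = 0 → ψ z = left (z.1.1, z.1.2.proj x₀) := by
    intro z hz
    by_cases h : z.1.1 ∈ B
    · rw [hψB z h, hk0 _ _ hz]
    · exact dif_neg h
  have hψ : Continuous ψ := by
    have hc0 : IsClosed {z : coneUnion B X | z.1.2.height = 0} :=
      isClosed_eq (by fun_prop) continuous_const
    have hcB : IsClosed {z : coneUnion B X | z.1.1 ∈ B} := hB.preimage (by fun_prop)
    have hu : {z : coneUnion B X | z.1.2.height = 0} ∪ {z : coneUnion B X | z.1.1 ∈ B} = univ :=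
      eq_univ_of_forall fun z => z.2
    rw [← continuousOn_univ, ← hu]
    refine ContinuousOn.union_of_isClosed ?_ ?_ hc0 hcB
    · refine ContinuousOn.congr (f := fun z : coneUnion B X => left (z.1.1, z.1.2.proj x₀)) ?_ hψ0
      refine continuous_left.comp_continuousOn (ContinuousOn.prodMk (by fun_prop) ?_)
      refine (Cone.continuousOn_proj x₀).comp (by fun_prop) fun z hz h => ?_
      rw [show z.1.2.height = 0 from hz] at h
      exact zero_ne_one h
    · rw [continuousOn_iff_continuous_domRestrict]
      have : Continuous fun z : {z : coneUnion B X | z.1.1 ∈ B} =>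
          k (⟨z.1.1.1, z.2⟩, z.1.1.2) := hk.comp (by fun_prop)
      convert this using 1
      ext1 z
      exact hψB _ z.2
  let Ψ : C(coneUnion B X, D) := ⟨ψ, hψ⟩
  refine ⟨⟨Ψ, Φ, ContinuousMap.Homotopic.symm ?_, ?_⟩⟩
  · let G : Cone X × I → Cone X := fun q => Quot.lift
      (fun p : X × I => Cone.mk p.1 (clampI ((1 + q.2) * p.2)))
      (fun p p' h => by
        have : clampI ((1 + q.2) * (1 : I)) = 1 :=
          clampI_of_one_le (by rw [Icc.coe_one]; linarith [q.2.2.1])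
        simp only [h.1, h.2, this]
        exact Cone.mk_one _ _) q.1
    have hG : ∀ x s t, G (Cone.mk x s, t) = Cone.mk x (clampI ((1 + t) * s)) := fun _ _ _ => rfl
    have hGc : Continuous G := by
      refine Cone.isQuotientMap_mk.continuous_lift_prod_left ?_
      simp only [hG]
      fun_prop
    have hGh : ∀ c t, Cone.height c = 0 → G (c, t) = c := by
      intro c t hc
      obtain ⟨x, s, rfl⟩ := Cone.exists_eq_mk c
      rw [Cone.height_mk] at hc
      rw [hG, hc]; simp
    let K : coneUnion B X × I → coneUnion B X := fun q => ⟨(q.1.1.1, G (q.1.1.2, q.2)),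
      q.1.2.imp (fun h => by dsimp only; rw [hGh _ _ h, h]) id⟩
    refine .of_continuous K (Continuous.subtype_mk (by fun_prop) _) ?_ ?_
    · rintro ⟨⟨a, c⟩, hz⟩
      apply Subtype.ext
      change (a, G (c, 0)) = (a, c)
      obtain ⟨x, s, rfl⟩ := Cone.exists_eq_mk c
      rw [hG]; simp
    · rintro ⟨⟨a, c⟩, hz⟩
      apply Subtype.ext
      change (a, G (c, 1)) = (Φ (ψ ⟨(a, c), hz⟩)).1
      by_cases h : c.height = 0
      · rw [hψ0 _ h, hGh _ _ h]
        change _ = (a, Cone.incl (c.proj x₀))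
        rw [Cone.incl_proj _ h]
      · have haB : a ∈ B := hz.resolve_left h
        obtain ⟨x, s, rfl⟩ := Cone.exists_eq_mk c
        have h2 : (1 + ((1 : I) : ℝ)) * s = 2 * s := by rw [Icc.coe_one]; ring
        rw [hψB _ haB, hG, h2]
        by_cases hs : (s : ℝ) ≤ 1 / 2
        · rw [hkle _ _ _ hs]
          change _ = (a, Cone.mk x (σ (clampI (1 - 2 * s))))
          congr 2
          apply Subtype.ext
          rw [coe_symm_eq, coe_clampI (by linarith [s.2.1]) (by linarith),
            coe_clampI (by linarith) (by linarith [s.2.1])]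
          ring
        · rw [hkgt _ _ _ hs]
          change _ = (a, Cone.mk x₀ 1)
          rw [clampI_of_one_le (by linarith), Cone.mk_one]
  · refine homotopic_id_of_reparam (θ := fun r => clampI (2 * r - 1)) (by fun_prop)
      (clampI_of_nonpos (by norm_num)) (clampI_of_one_le (by norm_num)) (fun y => ?_)
      (fun q r => ?_) (fun b => ?_)
    · change ψ ⟨(y.1, Cone.incl y.2), _⟩ = _
      rw [hψ0 _ rfl]
      simp
    · change ψ ⟨(q.1, Cone.mk q.2 (σ r)), _⟩ = _
      rw [hψB _ q.1.2]
      by_cases h : ((σ r : I) : ℝ) ≤ 1 / 2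
      · rw [hkle _ _ _ h, coe_symm_eq]
        congr 2; ring
      · rw [hkgt _ _ _ h, clampI_of_nonpos (by rw [coe_symm_eq] at h; linarith), cyl_zero]
    · change ψ ⟨(b, Cone.mk x₀ 1), _⟩ = _
      rw [hψB _ b.2, hkgt _ _ _ (by norm_num)]

/-- If the inclusion of the closed subspace `B` of `A` is null-homotopic and `B` is homotopy
equivalent to `P`, then `A × X ∪ B × CX` is a wedge of the join of `P` and `X` and a half-smash. -/
theorem nonempty_homotopyEquiv_coneUnion_wedge {A X P : Type*} [TopologicalSpace A]
    [TopologicalSpace X] [TopologicalSpace P] {B : Set A} (hB : IsClosed B) {a₀ : A}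
    (L : LocalContraction a₀) (x₀ : X) (p₀ : P)
    {N : B × I → A} (hN : Continuous N) (hN0 : ∀ b, N (b, 0) = b) (hN1 : ∀ b, N (b, 1) = a₀)
    {r : B → P} {s : P → B} {H : B × I → B} (hr : Continuous r) (hs : Continuous s)
    (hH : Continuous H) (hrs : ∀ p, r (s p) = p) (hH0 : ∀ b, H (b, 0) = b)
    (hH1 : ∀ b, H (b, 1) = s (r b)) :
    Nonempty (ContinuousMap.HomotopyEquiv (coneUnion B X)
      (Wedge (Join.base p₀ x₀) (HalfSmash.base a₀ x₀))) := by
  obtain ⟨e₁⟩ := nonempty_homotopyEquiv_coneUnion hB x₀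
  obtain ⟨e₂⟩ := DoubleCylinder.nonempty_homotopyEquiv_of_homotopy
    (f := fun q : B × X => ((q.1 : A), q.2)) (f' := fun q : B × X => (a₀, q.2))
    (g := (Prod.fst : B × X → B)) (H := fun q => (N (q.1.1, q.2), q.1.2)) (by fun_prop)
    (by simp [hN0]) (by simp [hN1])
  obtain ⟨e₃⟩ := DoubleCylinder.nonempty_homotopyEquiv_of_deformation (fun x : X => (a₀, x))
    hr hs hH hrs hH0 hH1
  obtain ⟨e₄⟩ := DoubleCylinder.nonempty_homotopyEquiv_join
    (F := fun x : X => (a₀, x)) (by fun_prop) p₀ x₀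
  -- The end `X` of the join slides along the segments towards `p₀`, to the point `Join.base p₀ x₀`,
  -- which does not depend on `x`.
  obtain ⟨e₅⟩ := DoubleCylinder.nonempty_homotopyEquiv_of_homotopy
    (f := fun x : X => Join.mk p₀ 1 x) (f' := fun _ : X => Join.base p₀ x₀)
    (g := fun x : X => (a₀, x)) (H := fun q => Join.mk p₀ (σ q.2) q.1) (by fun_prop)
    (by simp) (fun x => by simp only [symm_one]; exact Join.mk_zero _ _ _)
  obtain ⟨e₆⟩ := DoubleCylinder.nonempty_homotopyEquiv_wedge (Join.base p₀ x₀) L x₀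
  exact ⟨((((e₁.trans e₂).trans e₃).trans e₄).trans e₅).trans e₆⟩

/-! ### Decomposition of the polyhedral product along the last vertex -/

section Assembly

/-- A polyhedral product over `Fin (n + 1)` which is described by the first `n` coordinates and
the height of the last one is a union `A × X ∪ B × CX`. -/
theorem nonempty_homeomorph_coneUnion {n : ℕ} {X : Fin (n + 1) → Type*}
    [∀ i, TopologicalSpace (X i)] {S : Set (∀ i, Cone (X i))}
    {A : Set (∀ i : Fin n, Cone (X i.castSucc))} {B : Set A}
    (h : ∀ x, x ∈ S ↔ ∃ ha : (fun i : Fin n => x i.castSucc) ∈ A,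
      (x (Fin.last n)).height = 0 ∨ (⟨_, ha⟩ : A) ∈ B) :
    Nonempty (S ≃ₜ coneUnion B (X (Fin.last n))) := by
  refine ⟨{
    toFun := fun x => ⟨(⟨fun i => x.1 i.castSucc, ((h _).1 x.2).1⟩, x.1 (Fin.last n)),
      ((h _).1 x.2).2⟩
    invFun := fun z => ⟨Fin.snoc (α := fun i => Cone (X i)) z.1.1.1 z.1.2,
      (h _).2 ⟨by simp, by
        have hz : z.1.2.height = 0 ∨ z.1.1 ∈ B := z.2
        simpa using hz⟩⟩
    left_inv := fun x => Subtype.ext (Fin.snoc_init_self x.1)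
    right_inv := fun z => ?_
    continuous_toFun := ?_
    continuous_invFun := ?_ }⟩
  · apply Subtype.ext
    refine Prod.ext (Subtype.ext ?_) ?_ <;> simp
  · refine Continuous.subtype_mk (Continuous.prodMk (Continuous.subtype_mk ?_ _) ?_) _
    · exact continuous_pi fun i => (continuous_apply _).comp continuous_subtype_val
    · exact (continuous_apply _).comp continuous_subtype_val
  · exact Continuous.subtype_mk (Continuous.finSnoc (by fun_prop) (by fun_prop)) _

variable {n k : ℕ} {K : PreAbstractSimplicialComplex (Fin (n + 1))}
  {K₁ : PreAbstractSimplicialComplex (Fin n)}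

/-- The common face of `K₁` and the simplex on the last vertices. -/
theorem commonFace_mem
    (hI : K₁.map Fin.castSucc ⊓ fullSimplex {i : Fin (n + 1) | n ≤ (i : ℕ) + k} =
      fullSimplex {i : Fin (n + 1) | n ≤ (i : ℕ) + k ∧ (i : ℕ) < n}) :
    (({i : Fin n | n ≤ (i : ℕ) + k} : Finset (Fin n)) = ∅) ∨
      ({i : Fin n | n ≤ (i : ℕ) + k} : Finset (Fin n)) ∈ K₁ := by
  rcases Finset.eq_empty_or_nonempty ({i : Fin n | n ≤ (i : ℕ) + k} : Finset (Fin n)) with h | h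
  · exact Or.inl h
  refine Or.inr ?_
  have heq : ({i : Fin (n + 1) | n ≤ (i : ℕ) + k ∧ (i : ℕ) < n} : Finset (Fin (n + 1))) =
      ({i : Fin n | n ≤ (i : ℕ) + k} : Finset (Fin n)).image Fin.castSucc := by
    ext i
    simp only [Finset.mem_filter, Finset.mem_univ, true_and, Finset.mem_image]
    constructor
    · rintro ⟨h1, h2⟩
      exact ⟨⟨i, h2⟩, h1, rfl⟩
    · rintro ⟨j, hj, rfl⟩
      exact ⟨hj, j.2⟩
  have hmem : ({i : Fin (n + 1) | n ≤ (i : ℕ) + k ∧ (i : ℕ) < n} : Finset (Fin (n + 1))) ∈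
      fullSimplex ({i : Fin (n + 1) | n ≤ (i : ℕ) + k ∧ (i : ℕ) < n} : Finset (Fin (n + 1))) :=
    ⟨by rw [heq]; exact h.image _, subset_rfl⟩
  rw [← hI] at hmem
  obtain ⟨t, ht, hte⟩ := hmem.1
  rw [heq] at hte
  rwa [Finset.image_injective (Fin.castSucc_injective n) hte] at ht

/-- A face from `K₁` forces the last coordinate into the base. A face of the simplex leaves it free
but forces the coordinates outside the common face into the base; as the common face is empty or in
`K₁`, the first coordinates still lie in the polyhedral product of `K₁`. -/
theorem mem_conePolyhedralProduct_sup_fullSimplex {X : Fin (n + 1) → Type*}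
    (hK : K = K₁.map Fin.castSucc ⊔ fullSimplex {i : Fin (n + 1) | n ≤ (i : ℕ) + k})
    (hF : (({i : Fin n | n ≤ (i : ℕ) + k} : Finset (Fin n)) = ∅) ∨
      ({i : Fin n | n ≤ (i : ℕ) + k} : Finset (Fin n)) ∈ K₁) (x : ∀ i, Cone (X i)) :
    x ∈ conePolyhedralProduct X K ↔
      (fun i : Fin n => x i.castSucc) ∈ conePolyhedralProduct (fun i : Fin n => X i.castSucc) K₁ ∧
        ((x (Fin.last n)).height = 0 ∨ ∀ i : Fin n,
          i ∉ ({i : Fin n | n ≤ (i : ℕ) + k} : Finset (Fin n)) → (x i.castSucc).height = 0) := by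
  have hlast : ∀ t : Finset (Fin n), Fin.last n ∉ t.image Fin.castSucc := by
    intro t h
    obtain ⟨i, -, hi⟩ := Finset.mem_image.1 h
    exact (Fin.castSucc_lt_last i).ne hi
  rw [mem_conePolyhedralProduct, mem_conePolyhedralProduct]
  constructor
  · rintro ⟨τ, hτ, h⟩
    rcases hτ with rfl | hτ
    · exact ⟨⟨∅, Or.inl rfl, fun i _ => h _ (Finset.notMem_empty _)⟩,
        Or.inl (h _ (Finset.notMem_empty _))⟩
    rw [hK] at hτ
    rcases hτ with ⟨t, ht, rfl⟩ | ⟨-, hτ⟩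
    · refine ⟨⟨t, Or.inr ht, fun i hi => h _ fun hi' => hi ?_⟩, Or.inl (h _ (hlast t))⟩
      obtain ⟨j, hj, hji⟩ := Finset.mem_image.1 hi'
      rwa [← Fin.castSucc_injective n hji]
    · have hx : ∀ i : Fin n, i ∉ ({i : Fin n | n ≤ (i : ℕ) + k} : Finset (Fin n)) →
          (x i.castSucc).height = 0 := fun i hi => h _ fun hi' => hi <| by
        simpa using hτ hi'
      exact ⟨⟨_, hF, hx⟩, Or.inr hx⟩
  · rintro ⟨⟨t, ht, hx⟩, h | h⟩
    · refine ⟨t.image Fin.castSucc, ?_, fun i => ?_⟩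
      · rcases ht with rfl | ht
        · exact Or.inl rfl
        · rw [hK]
          exact Or.inr (Or.inl ⟨t, ht, rfl⟩)
      · refine Fin.lastCases (fun _ => h) (fun i hi => hx i fun hi' => hi ?_) i
        exact Finset.mem_image_of_mem _ hi'
    · refine ⟨({i : Fin (n + 1) | n ≤ (i : ℕ) + k} : Finset (Fin (n + 1))), Or.inr ?_, fun i => ?_⟩
      · rw [hK]
        exact Or.inr ⟨⟨Fin.last n, by simp⟩, subset_rfl⟩
      · refine Fin.lastCases (fun hi => (hi (by simp)).elim) (fun i hi => h i fun hi' => hi ?_) i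
        simpa using hi'

/-- The splitting of the polyhedral product, with the product of the first factors replaced by any
homeomorphic space `P`. -/
theorem nonempty_homotopyEquiv_conePolyhedralProduct {X : Fin (n + 1) → Type*}
    [∀ i, TopologicalSpace (X i)] {x₀ : ∀ i, X i} (L : ∀ i, LocalContraction (x₀ i))
    (hK₁ : ∀ i, {i} ∈ K₁)
    (hK : K = K₁.map Fin.castSucc ⊔ fullSimplex {i : Fin (n + 1) | n ≤ (i : ℕ) + k})
    (hI : K₁.map Fin.castSucc ⊓ fullSimplex {i : Fin (n + 1) | n ≤ (i : ℕ) + k} =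
      fullSimplex {i : Fin (n + 1) | n ≤ (i : ℕ) + k ∧ (i : ℕ) < n})
    {P : Type*} [TopologicalSpace P] (p₀ : P)
    (e : (∀ i : {i : Fin n // i ∉ ({i : Fin n | n ≤ (i : ℕ) + k} : Finset (Fin n))},
      X i.1.castSucc) ≃ₜ P) :
    Nonempty (ContinuousMap.HomotopyEquiv (conePolyhedralProduct X K)
      (Wedge (Join.base p₀ (x₀ (Fin.last n))) (HalfSmash.base
        (conePolyhedralProduct.base (fun i : Fin n => x₀ i.castSucc) K₁) (x₀ (Fin.last n))))) := by
  have hF := commonFace_mem hI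
  have hKm := mem_conePolyhedralProduct_sup_fullSimplex (X := X) hK hF
  -- From here only two facts about the common face matter: it is a simplex of `K₁`, and it
  -- describes membership in the polyhedral product of `K`.
  generalize ({i : Fin n | n ≤ (i : ℕ) + k} : Finset (Fin n)) = F at hF hKm e
  obtain ⟨LA⟩ := nonempty_localContraction_conePolyhedralProduct
    (fun i : Fin n => L i.castSucc) K₁
  obtain ⟨N, hN, hN0, hN1⟩ := exists_nullhomotopy_conePolyhedralPiece
    (fun i : Fin n => x₀ i.castSucc) hK₁ hF
  obtain ⟨r, s, H, hr, hs, hH, hrs, hH0, hH1⟩ := exists_deformation_conePolyhedralPiece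
    (fun i : Fin n => x₀ i.castSucc) F
  let piece := polyhedralPiece
    (fun i : Fin n => range (Cone.incl : X i.castSucc → Cone (X i.castSucc))) F
  let B : Set (conePolyhedralProduct (fun i : Fin n => X i.castSucc) K₁) := {a | a.1 ∈ piece}
  have hB : IsClosed B := by
    have : IsClosed piece := by
      have h : piece = ⋂ i, ⋂ (_ : i ∉ F), (fun x : ∀ i : Fin n, Cone (X i.castSucc) => x i) ⁻¹'
          range (Cone.incl : X i.castSucc → Cone (X i.castSucc)) := by
        ext x
        simp only [mem_iInter]
        rfl
      rw [h]
      exact isClosed_iInter fun i => isClosed_iInter fun _ =>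
        Cone.isClosed_range_incl.preimage (continuous_apply i)
    exact this.preimage continuous_subtype_val
  -- The whole piece lies in the polyhedral product of `K₁`, so `j` and `j'` are mutually inverse
  -- and transport the deformation and the null-homotopy to `B`.
  let j : B → piece := fun b => ⟨b.1.1, b.2⟩
  have hj : Continuous j := by fun_prop
  let j' : piece → B := fun b => ⟨⟨b.1, mem_conePolyhedralProduct.2
    ⟨F, hF, mem_conePolyhedralPiece.1 b.2⟩⟩, b.2⟩
  have hj' : Continuous j' := by fun_prop
  obtain ⟨h₁⟩ := nonempty_homeomorph_coneUnion (S := conePolyhedralProduct X K) (B := B)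
    (fun x => by
      rw [hKm x]
      exact ⟨fun h => ⟨h.1, h.2.imp_right fun h' => mem_conePolyhedralPiece.2 h'⟩,
        fun h => ⟨h.1, h.2.imp_right fun h' => mem_conePolyhedralPiece.1 h'⟩⟩)
  obtain ⟨h₂⟩ := nonempty_homotopyEquiv_coneUnion_wedge hB LA (x₀ (Fin.last n)) p₀
    (N := fun q => N (j q.1, q.2)) (by fun_prop) (fun b => Subtype.ext (hN0 (j b)))
    (fun b => hN1 (j b))
    (r := fun b => e (r (j b))) (s := fun p => j' (s (e.symm p)))
    (H := fun q => j' (H (j q.1, q.2))) (by fun_prop) (by fun_prop) (by fun_prop)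
    (fun p => by
      change e (r (s (e.symm p))) = p
      rw [hrs, e.apply_symm_apply])
    (fun b => by
      simp only [hH0]
      rfl)
    (fun b => by
      simp only [hH1, e.symm_apply_apply])
  exact ⟨h₁.toHomotopyEquiv.trans h₂⟩

/-- With `k = 0` the simplex is the last vertex alone, so the corollary is the case of adding one
isolated point. -/
theorem disjointPoints_succ (n : ℕ) : disjointPoints (n + 1) =
    (disjointPoints n).map Fin.castSucc ⊔
      fullSimplex {i : Fin (n + 1) | n ≤ (i : ℕ) + 0} := by
  ext s
  constructor
  · rintro ⟨v, rfl⟩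
    refine Fin.lastCases (Or.inr ?_) (fun i => Or.inl ?_) v
    · exact ⟨Finset.singleton_nonempty _, by simp⟩
    · exact ⟨{i}, ⟨i, rfl⟩, by simp⟩
  · rintro (⟨_, ⟨v, rfl⟩, rfl⟩ | ⟨hne, hs⟩)
    · exact ⟨v.castSucc, by simp⟩
    · obtain ⟨v, hv⟩ := hne
      refine ⟨Fin.last n, (Finset.Nonempty.subset_singleton_iff ⟨v, hv⟩).1 fun i hi => ?_⟩
      have := hs hi
      simp only [Finset.mem_filter, Finset.mem_univ, true_and, add_zero] at this
      exact Finset.mem_singleton.2 (Fin.ext (le_antisymm (Fin.le_last i) this))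

theorem disjointPoints_inf (n : ℕ) : (disjointPoints n).map Fin.castSucc ⊓
      fullSimplex {i : Fin (n + 1) | n ≤ (i : ℕ) + 0} =
    fullSimplex {i : Fin (n + 1) | n ≤ (i : ℕ) + 0 ∧ (i : ℕ) < n} := by
  ext s
  constructor
  · rintro ⟨⟨_, ⟨v, rfl⟩, rfl⟩, -, hs⟩
    have := hs (Finset.mem_image_of_mem _ (Finset.mem_singleton_self v))
    simp only [Finset.mem_filter, Finset.mem_univ, true_and, add_zero, Fin.val_castSucc] at this
    exact absurd v.2 (not_lt.2 this)
  · rintro ⟨⟨v, hv⟩, hs⟩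
    have := hs hv
    simp only [Finset.mem_filter, Finset.mem_univ, true_and, add_zero] at this
    exact absurd this.2 (not_lt.2 this.1)

end Assembly

end

/-- The vertices `1, …, m` are the elements `0, …, n` of `Fin (n + 1)`, where `m = n + 1`;
so `{m - k, …, m}` is `{i | n ≤ i + k}`, and `{1, …, m - 1}` is the image of `Fin n`. -/
theorem mainTheorem4 {n : ℕ} (X : Fin (n + 1) → Type*) [∀ i, TopologicalSpace (X i)]
    [∀ i, T2Space (X i)] [∀ i, Topology.CWComplex (Set.univ : Set (X i))] (x₀ : ∀ i, X i) :
    (∀ (k : ℕ), k ≤ n →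
      ∀ (K : PreAbstractSimplicialComplex (Fin (n + 1))) (K₁ : PreAbstractSimplicialComplex (Fin n)),
      (∀ i : Fin n, {i} ∈ K₁) →
      K = K₁.map Fin.castSucc ⊔ fullSimplex {i : Fin (n + 1) | n ≤ (i : ℕ) + k} →
      K₁.map Fin.castSucc ⊓ fullSimplex {i : Fin (n + 1) | n ≤ (i : ℕ) + k} =
        fullSimplex {i : Fin (n + 1) | n ≤ (i : ℕ) + k ∧ (i : ℕ) < n} →
      Nonempty (ContinuousMap.HomotopyEquiv
        (conePolyhedralProduct X K)
        (Wedge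
          (Join.base (fun i : {i : Fin (n + 1) // (i : ℕ) + k < n} => x₀ i) (x₀ (Fin.last n)))
          (HalfSmash.base
            (conePolyhedralProduct.base (fun i : Fin n => x₀ i.castSucc) K₁)
            (x₀ (Fin.last n)))))) ∧
    Nonempty (ContinuousMap.HomotopyEquiv
      (conePolyhedralProduct X (disjointPoints (n + 1)))
      (Wedge
        (Join.base (fun i : Fin n => x₀ i.castSucc) (x₀ (Fin.last n)))
        (HalfSmash.base
          (conePolyhedralProduct.base (fun i : Fin n => x₀ i.castSucc) (disjointPoints n))
          (x₀ (Fin.last n))))) := by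
  have L : ∀ i, LocalContraction (x₀ i) := fun i =>
    (CWExtension.nonempty_localContraction (x₀ i)).some
  refine ⟨fun k _ K K₁ hK₁ hK hI => ?_, ?_⟩
  · refine nonempty_homotopyEquiv_conePolyhedralProduct L hK₁ hK hI
      (fun i : {i : Fin (n + 1) // (i : ℕ) + k < n} => x₀ i) ?_
    exact
      { toFun := fun p i => p ⟨⟨i.1, by have := i.2; omega⟩, by have := i.2; simpa using this⟩
        invFun := fun p i => p ⟨i.1.castSucc, by have := i.2; simpa using this⟩
        left_inv := fun _ => rfl
        right_inv := fun _ => rfl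
        continuous_toFun := continuous_pi fun i => continuous_apply _
        continuous_invFun := continuous_pi fun i => continuous_apply _ }
  -- For `k = 0` the common face is empty, so the join factor is the product over all of `Fin n`;
  -- the homeomorphism only removes the vacuous condition on the index.
  · refine nonempty_homotopyEquiv_conePolyhedralProduct (k := 0) (K₁ := disjointPoints n) L
      (fun i => show _ ∈ (disjointPoints n).faces from ⟨i, rfl⟩)
      (disjointPoints_succ n) (disjointPoints_inf n) (fun i : Fin n => x₀ i.castSucc) ?_
    exact
      { toFun := fun p i => p ⟨i, by simp⟩
        invFun := fun p i => p i.1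
        left_inv := fun _ => rfl
        right_inv := fun _ => rfl
        continuous_toFun := continuous_pi fun i => continuous_apply _
        continuous_invFun := continuous_pi fun i => continuous_apply _ }
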